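/- **Theorem 1.1.** *Setting.* Let $\epsilon,\mu,\sigma$ and $\epsilon_0,\mu_0,\sigma_0$ be real-valued, essentially bounded functions on $\mathbb R^3$ such that $\epsilon,\mu,\epsilon_0,\mu_0$ have positive essential infimum and $\sigma,\sigma_0\ge 0$ almost everywhere. Let $D\subset\mathbb R^3$ be a nonempty bounded open set such that $\mathbb R^3\setminus\overline D$ is connected, and suppose that almost everywhere $\epsilon/\epsilon_0=1$, $\mu/\mu_0=1$, $\sigma=\sigma_0$ outside $D$, and $\epsilon/\epsilon_0=1+e$, $\mu/\mu_0=1+m$, $\sigma=\sigma_0+h$ in $D$, where $e,m,h$ are essentially bounded functions on $D$. Let $0<T<\infty$ be arbitrary, let $B$ be an open ball (of positive radius) with $\overline B\cap\overline D=\emptyset$, let $a\in\mathbb R^3$ be a unit vector, let $f\in H^1(0,T)$ with $f(0)=0$, and set $J(x,t)=f(t)\chi_B(x)a$, where $\chi_B$ is the characteristic function of $B$. Let $(E,H)$ be a weak solution, in $L^\infty(0,T;L^2(\mathbb R^3)^3)^2$, of $$\epsilon\,\partial_tE-\nabla\times H=-\sigma E+J,\qquad \mu\,\partial_tH+\nabla\times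 E=0\quad\text{in }\mathbb R^3\times(0,T),\qquad E|_{t=0}=H|_{t=0}=0,$$ that is, for all $\Phi\in L^2(\mathbb R^3)^3$ with distributional curl $\nabla\times\Phi\in L^2(\mathbb R^3)^3$ and all $\psi\in C_c^\infty((-\infty,T))$, $$-\int_0^T\psi'(t)\int_{\mathbb R^3}\epsilon E\cdot\Phi\,dx\,dt=\int_0^T\psi(t)\int_{\mathbb R^3}\bigl(H\cdot\nabla\times\Phi-\sigma E\cdot\Phi+J\cdot\Phi\bigr)dx\,dt,$$ $$-\int_0^T\psi'(t)\int_{\mathbb R^3}\mu H\cdot\Phi\,dx\,dt=-\int_0^T\psi(t)\int_{\mathbb R^3}E\cdot\nabla\times\Phi\,dx\,dt .$$ Let $(E_0,H_0)$ be a weak solution in the same sense of the same problem with $\epsilon,\mu,\sigma$ replaced by $\epsilon_0,\mu_0,\sigma_0$ (and the same $J$). For $\tau>0$ set $$W_e=\int_0^Te^{-\tau t}E\,dt,\qquad V_e=\int_0^Te^{-\tau t}E_0\,dt,\qquad V_m=\int_0^Te^{-\tau t}H_0\,dt,\qquad \mathbf f=\int_0^Te^{-\tau t}J\,dt,$$ $$I(\tau)=\int_{\mathbb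 R^3}\mathbf f\cdot(W_e-V_e)\,dx,\qquad \tilde\epsilon=\epsilon+\frac{\sigma}{\tau},\qquad \tilde\epsilon_0=\epsilon_0+\frac{\sigma_0}{\tau}.$$ *Conclusion.* As $\tau\to\infty$, $$I(\tau)\le\tau\int_{\mathbb R^3}\Bigl\{\frac{\tilde\epsilon_0}{\tilde\epsilon}(\tilde\epsilon_0-\tilde\epsilon)|V_e|^2+(\mu-\mu_0)|V_m|^2\Bigr\}dx+O(\tau^{-5/2}e^{-\tau T})$$ and $$I(\tau)\ge\tau\int_{\mathbb R^3}\Bigl\{(\tilde\epsilon_0-\tilde\epsilon)|V_e|^2+\frac{\mu_0}{\mu}(\mu-\mu_0)|V_m|^2\Bigr\}dx+O(\tau^{-5/2}e^{-\tau T}).$$ -/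

import Mathlib

open MeasureTheory Set Filter Asymptotics
open scoped ContDiff

/-- Three-dimensional Euclidean space. -/
abbrev E3 : Type := EuclideanSpace ℝ (Fin 3)

/-- Square-integrable real vector fields on the whole space. -/
abbrev L2Field : Type := Lp E3 2 (volume : Measure E3)

/-- The partial derivative `∂ φ_j / ∂ x_i` at `x`. -/
noncomputable def partialDeriv (i j : Fin 3) (φ : E3 → E3) (x : E3) : ℝ :=
  (fderiv ℝ φ x (EuclideanSpace.single i 1)) j

/-- The classical curl of a (differentiable) vector field. -/
noncomputable def curl (φ : E3 → E3) (x : E3) : E3 :=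
  !₂[partialDeriv 1 2 φ x - partialDeriv 2 1 φ x,
     partialDeriv 2 0 φ x - partialDeriv 0 2 φ x,
     partialDeriv 0 1 φ x - partialDeriv 1 0 φ x]

/-- `w` is the curl of `u` in the sense of distributions, both being square integrable; thus
`u` belongs to `H(curl)` if and only if `HasWeakCurl u w` for some `w`. -/
def HasWeakCurl (u w : L2Field) : Prop :=
  ∀ φ : E3 → E3, ContDiff ℝ ∞ φ → HasCompactSupport φ →
    ∫ x, inner ℝ (u x) (curl φ x) = ∫ x, inner ℝ (w x) (φ x)

/-- The coefficients of an isotropic medium: the permittivity `ε`, the permeability `μ` and the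
conductivity `σ` are essentially bounded, the essential infima of `ε` and `μ` are positive and
that of `σ` is nonnegative. -/
structure IsMedium (ε μ σ : E3 → ℝ) : Prop where
  permittivity_bdd : MemLp ε ⊤ volume
  permeability_bdd : MemLp μ ⊤ volume
  conductivity_bdd : MemLp σ ⊤ volume
  permittivity_pos : ∃ c : ℝ, 0 < c ∧ ∀ᵐ x, c ≤ ε x
  permeability_pos : ∃ c : ℝ, 0 < c ∧ ∀ᵐ x, c ≤ μ x
  conductivity_nonneg : ∀ᵐ x, 0 ≤ σ x

/-- The (continuous representative of a) function of the Sobolev space `H¹(0, T)`: `f` is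
continuous on `[0, T]` and has a weak derivative in `L²(0, T)`. -/
def MemH1 (T : ℝ) (f : ℝ → ℝ) : Prop :=
  ContinuousOn f (Icc 0 T) ∧
    ∃ g : ℝ → ℝ, MemLp g 2 (volume.restrict (Ioo 0 T)) ∧
      ∀ ψ : ℝ → ℝ, ContDiff ℝ ∞ ψ → HasCompactSupport ψ → tsupport ψ ⊆ Ioo 0 T →
        ∫ t in Ioo 0 T, f t * deriv ψ t = - ∫ t in Ioo 0 T, g t * ψ t

/-- The current density `J(x, t) = f(t) χ_B(x) a`, with the time as the first argument. -/
noncomputable def currentDensity (f : ℝ → ℝ) (B : Set E3) (a : E3) (t : ℝ) (x : E3) : E3 :=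
  f t • B.indicator (fun _ => a) x

/-- `(E, H)` is a weak solution, in `L^∞(0, T; L²)`, of the initial value problem
`ε ∂ₜE - curl H = -σ E + J`, `μ ∂ₜH + curl E = 0` in `ℝ³ × (0, T)`, `E = H = 0` at `t = 0`.
The test fields are the products `ψ(t) Φ(x)` with `Φ ∈ H(curl)` (whose curl is `Ψ`) and
`ψ` smooth and vanishing near `T`. Since `ψ(0)` is arbitrary and there is no term at `t = 0`,
the identities contain the vanishing initial conditions. -/
structure IsWeakMaxwellSolution (T : ℝ) (ε μ σ : E3 → ℝ) (J : ℝ → E3 → E3)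
    (E H : ℝ → L2Field) : Prop where
  electric_mem : MemLp E ⊤ (volume.restrict (Ioo 0 T))
  magnetic_mem : MemLp H ⊤ (volume.restrict (Ioo 0 T))
  ampere : ∀ Φ Ψ : L2Field, HasWeakCurl Φ Ψ →
    ∀ ψ : ℝ → ℝ, ContDiff ℝ ∞ ψ → HasCompactSupport ψ → tsupport ψ ⊆ Iio T →
      - ∫ t in Ioo 0 T, deriv ψ t * ∫ x, ε x * inner ℝ (E t x) (Φ x)
        = ∫ t in Ioo 0 T, ψ t *
            ((∫ x, inner ℝ (H t x) (Ψ x)) - (∫ x, σ x * inner ℝ (E t x) (Φ x))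
              + ∫ x, inner ℝ (J t x) (Φ x))
  faraday : ∀ Φ Ψ : L2Field, HasWeakCurl Φ Ψ →
    ∀ ψ : ℝ → ℝ, ContDiff ℝ ∞ ψ → HasCompactSupport ψ → tsupport ψ ⊆ Iio T →
      - ∫ t in Ioo 0 T, deriv ψ t * ∫ x, μ x * inner ℝ (H t x) (Φ x)
        = - ∫ t in Ioo 0 T, ψ t * ∫ x, inner ℝ (E t x) (Ψ x)

/-- The truncated Laplace transform `∫₀ᵀ e^{-τ t} F(t) dt` of an `L²`-valued field
(a Bochner integral in `L²`). -/
noncomputable def laplaceField (T : ℝ) (F : ℝ → L2Field) (τ : ℝ) : L2Field :=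
  ∫ t in Ioo 0 T, Real.exp (-(τ * t)) • F t

/-- The truncated Laplace transform `f(x, τ) = ∫₀ᵀ e^{-τ t} J(x, t) dt` of the current density. -/
noncomputable def laplaceSource (T : ℝ) (J : ℝ → E3 → E3) (τ : ℝ) (x : E3) : E3 :=
  ∫ t in Ioo 0 T, Real.exp (-(τ * t)) • J t x

/-- The indicator function `I(τ) = ∫ f · (W_e - V_e) dx`, where `W_e` and `V_e` are the truncated
Laplace transforms of `E` and of the background field `E₀`. -/
noncomputable def indicatorFunction (T : ℝ) (J : ℝ → E3 → E3) (E E₀ : ℝ → L2Field) (τ : ℝ) : ℝ :=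
  ∫ x, inner ℝ (laplaceSource T J τ x) (laplaceField T E τ x - laplaceField T E₀ τ x)

/-- The function `ε + σ / τ`. -/
noncomputable def effPermittivity (ε σ : E3 → ℝ) (τ : ℝ) (x : E3) : ℝ :=
  ε x + σ x / τ

/-! Write `W`, `V` for the truncated transforms of `E`, `H`, with a subscript `0` for the
background; `κ = ε + σ/τ`, `s = χ_B a`, and `c` is the transform of `f`. Transforming Maxwell's
equations gives a stationary system `curl V = τκW - cs + F`, `curl W = -τμV + G`, whose residuals
come from the cut at time `T` and are `O(e^{-τT})` in `L²`.

Testing the Ampère law of one solution with the electric field of another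
(`IsStationarySolution.reciprocity`) gives four identities, up to residual terms: `τ∫(κ|W|² + μ|V|²)
= c⟨s,W⟩`, `τ∫(κ₀|W₀|² + μ₀|V₀|²) = c⟨s,W₀⟩`, `τ∫(κ W·W₀ + μ₀ V·V₀) = c⟨s,W₀⟩`, `τ∫(κ₀ W·W₀ + μ
V·V₀) = c⟨s,W⟩`. The indicator function is `c⟨s,W⟩ - c⟨s,W₀⟩`. Two different combinations of these
identities express it, and completing squares removes `W` and `V`, from above in one and from below
in the other (`IsStationarySolution.indicator_bounds`).

For the remainder, `f ∈ H¹` and `f(0) = 0` give `c = O(τ^{-3/2})`, and coercivity gains a factor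
`1/τ`, so the fields are `O(τ^{-5/2})`. Each residual term pairs such a field with an `O(e^{-τT})`
residual. -/

/-! ### Truncated Laplace transform of a weak time derivative -/

/-- A smooth cut-off function which equals `1` on `[0, T - 2 * δ]` and vanishes on `[T - δ, ∞)`. -/
noncomputable def timeCutoff (T δ t : ℝ) : ℝ :=
  Real.smoothTransition (t + 1) * Real.smoothTransition ((T - δ - t) / δ)

theorem contDiff_timeCutoff (T δ : ℝ) : ContDiff ℝ ∞ (timeCutoff T δ) := by
  unfold timeCutoff
  exact (Real.smoothTransition.contDiff.comp (by fun_prop)).mul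
    (Real.smoothTransition.contDiff.comp (by fun_prop))

theorem timeCutoff_eq_zero {T δ : ℝ} (hδ : 0 < δ) {t : ℝ} (ht : t ∉ Icc (-1) (T - δ)) :
    timeCutoff T δ t = 0 := by
  rw [mem_Icc, not_and_or, not_le, not_le] at ht
  rcases ht with ht | ht
  · rw [timeCutoff, Real.smoothTransition.zero_of_nonpos (by linarith), zero_mul]
  · rw [timeCutoff, Real.smoothTransition.zero_of_nonpos (x := (T - δ - t) / δ)
      (div_nonpos_of_nonpos_of_nonneg (by linarith) hδ.le), mul_zero]

/-- The factor `smoothTransition (t + 1)` serves only this purpose: it cuts off at `t = -1` and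
equals `1` for `t ≥ 0`. -/
theorem hasCompactSupport_timeCutoff {T δ : ℝ} (hδ : 0 < δ) :
    HasCompactSupport (timeCutoff T δ) :=
  HasCompactSupport.intro isCompact_Icc fun _ ht => timeCutoff_eq_zero hδ ht

theorem tsupport_timeCutoff_subset {T δ : ℝ} (hδ : 0 < δ) :
    tsupport (timeCutoff T δ) ⊆ Iio T := by
  have h : tsupport (timeCutoff T δ) ⊆ Icc (-1) (T - δ) :=
    closure_minimal (fun t ht => by
      by_contra h
      exact ht (timeCutoff_eq_zero hδ h)) isClosed_Icc
  exact h.trans fun t ht => by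
    have := ht.2
    simp only [mem_Iio]
    linarith

theorem timeCutoff_nonneg (T δ t : ℝ) : 0 ≤ timeCutoff T δ t :=
  mul_nonneg (Real.smoothTransition.nonneg _) (Real.smoothTransition.nonneg _)

theorem timeCutoff_le_one (T δ t : ℝ) : timeCutoff T δ t ≤ 1 :=
  mul_le_one₀ (Real.smoothTransition.le_one _) (Real.smoothTransition.nonneg _)
    (Real.smoothTransition.le_one _)

theorem timeCutoff_eq_one {T δ t : ℝ} (hδ : 0 < δ) (ht : 0 ≤ t) (htT : t ≤ T - 2 * δ) :
    timeCutoff T δ t = 1 := by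
  rw [timeCutoff, Real.smoothTransition.one_of_one_le (by linarith),
    Real.smoothTransition.one_of_one_le ((one_le_div hδ).2 (by linarith)), one_mul]

theorem deriv_timeCutoff_nonpos {T δ t : ℝ} (hδ : 0 < δ) (ht : 0 < t) :
    deriv (timeCutoff T δ) t ≤ 0 := by
  have h : timeCutoff T δ =ᶠ[nhds t] fun s => Real.smoothTransition ((T - δ - s) / δ) := by
    filter_upwards [Ioi_mem_nhds ht] with s hs
    rw [timeCutoff, Real.smoothTransition.one_of_one_le (by linarith [mem_Ioi.1 hs]), one_mul]
  rw [h.deriv_eq]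
  have : Antitone fun s => Real.smoothTransition ((T - δ - s) / δ) := fun x y hxy =>
    Real.smoothTransition.monotone (by gcongr)
  exact this.deriv_nonpos

theorem tendsto_timeCutoff {T t : ℝ} (hT : 0 < T) (ht : t ∈ Ioo 0 T) :
    Tendsto (fun n : ℕ => timeCutoff T (T / (n + 2)) t) atTop (nhds 1) := by
  have h0 : Tendsto (fun n : ℕ => 2 * (T / ((n : ℝ) + 2))) atTop (nhds 0) := by
    have := (tendsto_const_nhds (x := T)).div_atTop
      (tendsto_natCast_atTop_atTop.atTop_add (tendsto_const_nhds (x := (2 : ℝ))))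
    simpa using this.const_mul 2
  refine tendsto_const_nhds.congr' ?_
  filter_upwards [h0.eventually (gt_mem_nhds (sub_pos.2 ht.2))] with n hn
  exact (timeCutoff_eq_one (by positivity) ht.1.le (by linarith)).symm

theorem integral_deriv_Ioo {ψ : ℝ → ℝ} (hψ : ContDiff ℝ ∞ ψ) {T : ℝ} (hT : 0 ≤ T) :
    ∫ t in Ioo 0 T, deriv ψ t = ψ T - ψ 0 := by
  rw [← integral_Ioc_eq_integral_Ioo, ← intervalIntegral.integral_of_le hT]
  exact intervalIntegral.integral_deriv_eq_sub
    (fun x _ => (hψ.differentiable (by simp)).differentiableAt)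
    ((hψ.continuous_deriv (by simp)).intervalIntegrable _ _)

theorem integrableOn_Ioo_mul_of_continuous {ψ b : ℝ → ℝ} {T : ℝ} (hψ : Continuous ψ)
    (hb : IntegrableOn b (Ioo 0 T)) : IntegrableOn (fun t => ψ t * b t) (Ioo 0 T) := by
  obtain ⟨C, hC⟩ := isCompact_Icc.exists_bound_of_continuousOn (s := Icc 0 T) hψ.continuousOn
  refine Integrable.bdd_mul hb hψ.aestronglyMeasurable (c := C) ?_
  filter_upwards [ae_restrict_mem measurableSet_Ioo] with t ht
  exact hC t (Ioo_subset_Icc_self ht)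

/-- Identifies the limiting mass of the cut-off derivatives below, and also yields `∫ e^{-τt} ≤
1/τ`. -/
theorem integral_exp_Ioo {T : ℝ} (hT : 0 ≤ T) (τ : ℝ) :
    1 - τ * ∫ t in Ioo 0 T, Real.exp (-(τ * t)) = Real.exp (-(τ * T)) := by
  have h := integral_deriv_Ioo (ψ := fun t => Real.exp (-(τ * t))) (by fun_prop) hT
  have hd : ∀ t, deriv (fun t => Real.exp (-(τ * t))) t = -τ * Real.exp (-(τ * t)) := fun t => by
    have : HasDerivAt (fun t => Real.exp (-(τ * t))) (Real.exp (-(τ * t)) * -(τ * 1)) t :=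
      (((hasDerivAt_id t).const_mul τ).neg).exp
    rw [this.deriv]; ring
  simp_rw [hd, integral_const_mul] at h
  simp only [mul_zero, neg_zero, Real.exp_zero] at h
  linarith

/-- If `b` has weak derivative `g` on `(0, T)` and vanishes at `0`, then its truncated Laplace
transform satisfies the usual differentiation rule up to the boundary term at `T`. -/
theorem abs_laplace_weakDeriv_sub_le {T K : ℝ} (hT : 0 < T) {b g : ℝ → ℝ}
    (hb : IntegrableOn b (Ioo 0 T)) (hg : IntegrableOn g (Ioo 0 T))
    (hK : ∀ᵐ t ∂volume.restrict (Ioo 0 T), |b t| ≤ K)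
    (h : ∀ ψ : ℝ → ℝ, ContDiff ℝ ∞ ψ → HasCompactSupport ψ → tsupport ψ ⊆ Iio T →
      - ∫ t in Ioo 0 T, deriv ψ t * b t = ∫ t in Ioo 0 T, ψ t * g t) (τ : ℝ) :
    |(∫ t in Ioo 0 T, Real.exp (-(τ * t)) * g t)
      - τ * ∫ t in Ioo 0 T, Real.exp (-(τ * t)) * b t| ≤ K * Real.exp (-(τ * T)) := by
  -- The shift `n + 2` ensures `2δ ≤ T` already for `n = 0`, so that `χ n 0 = 1`.
  set χ : ℕ → ℝ → ℝ := fun n => timeCutoff T (T / (n + 2)) with hχ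
  set ψ : ℕ → ℝ → ℝ := fun n t => Real.exp (-(τ * t)) * χ n t with hψ
  have hδ : ∀ n : ℕ, 0 < T / ((n : ℝ) + 2) := fun n => by positivity
  have hχs : ∀ n, ContDiff ℝ ∞ (χ n) := fun n => contDiff_timeCutoff _ _
  have hψs : ∀ n, ContDiff ℝ ∞ (ψ n) := fun n =>
    ContDiff.mul (by fun_prop) (hχs n)
  have hlim : ∀ k : ℝ → ℝ, IntegrableOn k (Ioo 0 T) →
      Tendsto (fun n => ∫ t in Ioo 0 T, ψ n t * k t) atTop
        (nhds (∫ t in Ioo 0 T, Real.exp (-(τ * t)) * k t)) := by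
    intro k hk
    refine tendsto_integral_of_dominated_convergence (fun t => |Real.exp (-(τ * t)) * k t|)
      (fun n => ((hψs n).continuous.aestronglyMeasurable.mul hk.1))
      (integrableOn_Ioo_mul_of_continuous (by fun_prop) hk).abs ?_ ?_
    · intro n
      refine Eventually.of_forall fun t => ?_
      simp only [hψ, hχ, Real.norm_eq_abs, abs_mul, abs_of_nonneg (timeCutoff_nonneg _ _ _)]
      calc _ ≤ |Real.exp (-(τ * t))| * 1 * |k t| := by gcongr; exact timeCutoff_le_one _ _ _
        _ = _ := by ring
    · filter_upwards [ae_restrict_mem measurableSet_Ioo] with t ht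
      have := ((tendsto_timeCutoff hT ht).const_mul (Real.exp (-(τ * t)))).mul_const (k t)
      simpa using this
  have hd : ∀ n t, deriv (ψ n) t = -τ * ψ n t + Real.exp (-(τ * t)) * deriv (χ n) t := by
    intro n t
    have h1 : HasDerivAt (fun t => Real.exp (-(τ * t))) (Real.exp (-(τ * t)) * -(τ * 1)) t :=
      (((hasDerivAt_id t).const_mul τ).neg).exp
    have h2 := h1.mul ((hχs n).differentiable (by simp) t).hasDerivAt
    have h3 : deriv (ψ n) t = _ := h2.deriv
    rw [h3]; simp only [hψ]; ring
  -- Since `b` need not have a value at `T`, the boundary term appears as `∫ e^{-τt} χₙ' b`. As `χₙ'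
  -- ≤ 0` on `(0, T)`, it is at most `K` times the mass of `-e^{-τt} χₙ'`, which integration by
  -- parts turns into `1 - τ∫ψₙ`; this tends to `e^{-τT}`.
  have hbound : ∀ n, |(∫ t in Ioo 0 T, ψ n t * g t) - τ * ∫ t in Ioo 0 T, ψ n t * b t|
      ≤ K * (1 - τ * ∫ t in Ioo 0 T, ψ n t * 1) := by
    intro n
    have hc1 : Continuous (deriv (χ n)) := (hχs n).continuous_deriv (by simp)
    have hc2 : Continuous fun t => Real.exp (-(τ * t)) * deriv (χ n) t :=
      (by fun_prop : Continuous fun t => Real.exp (-(τ * t))).mul hc1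
    have hi1 : IntegrableOn (fun _ : ℝ => (1 : ℝ)) (Ioo 0 T) := by simp
    have e1 : (∫ t in Ioo 0 T, ψ n t * g t) - τ * ∫ t in Ioo 0 T, ψ n t * b t
        = - ∫ t in Ioo 0 T, (Real.exp (-(τ * t)) * deriv (χ n) t) * b t := by
      rw [← h (ψ n) (hψs n) ((hasCompactSupport_timeCutoff (hδ n)).mul_left)
        ((tsupport_mul_subset_right).trans (tsupport_timeCutoff_subset (hδ n)))]
      rw [← integral_const_mul, ← integral_neg, ← integral_neg, ← integral_sub]
      · refine integral_congr_ae (Eventually.of_forall fun t => ?_)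
        simp only [hd]; ring
      · exact (integrableOn_Ioo_mul_of_continuous
          ((hψs n).continuous_deriv (by simp)) hb).neg
      · exact (integrableOn_Ioo_mul_of_continuous (hψs n).continuous hb).const_mul τ
    have e2 : 1 - τ * ∫ t in Ioo 0 T, ψ n t * 1
        = ∫ t in Ioo 0 T, - (Real.exp (-(τ * t)) * deriv (χ n) t) := by
      have := integral_deriv_Ioo (hψs n) hT.le
      have h0 : ψ n 0 = 1 := by
        simp only [hψ, hχ]
        rw [timeCutoff_eq_one (hδ n) le_rfl]
        · simp
        · have : T / ((n : ℝ) + 2) ≤ T / 2 := by gcongr; linarith [n.cast_nonneg (α := ℝ)]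
          linarith
      have h1 : ψ n T = 0 := by
        simp only [hψ, hχ]
        rw [timeCutoff_eq_zero (hδ n) (fun ht => by linarith [ht.2, hδ n]), mul_zero]
      rw [h0, h1] at this
      simp_rw [hd] at this
      rw [integral_add, integral_const_mul] at this
      · rw [integral_neg]; simp only [mul_one]; linarith
      · simpa using! (integrableOn_Ioo_mul_of_continuous (hψs n).continuous hi1).const_mul (-τ)
      · simpa using! integrableOn_Ioo_mul_of_continuous hc2 hi1
    rw [e1, e2, abs_neg, ← integral_const_mul]
    refine (abs_integral_le_integral_abs).trans (integral_mono_ae ?_ ?_ ?_)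
    · exact (integrableOn_Ioo_mul_of_continuous hc2 hb).abs
    · simpa using! (integrableOn_Ioo_mul_of_continuous hc2 hi1).neg.const_mul K
    · filter_upwards [hK, ae_restrict_mem measurableSet_Ioo] with t ht ht'
      have := deriv_timeCutoff_nonpos (T := T) (hδ n) ht'.1
      simp only [abs_mul, Real.abs_exp, hχ, abs_of_nonpos this]
      have h0 : 0 ≤ Real.exp (-(τ * t)) * -deriv (timeCutoff T (T / (n + 2))) t :=
        mul_nonneg (Real.exp_nonneg _) (by linarith)
      nlinarith [mul_le_mul_of_nonneg_left ht h0]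
  have hl := (((hlim g hg).sub ((hlim b hb).const_mul τ)).abs)
  have hr := (((hlim (fun _ => 1) (by simp)).const_mul τ).const_sub 1).const_mul K
  simp only [mul_one] at hr
  rw [integral_exp_Ioo hT.le] at hr
  refine le_of_tendsto_of_tendsto' hl hr fun n => ?_
  simpa using hbound n

/-! ### Decay of the transform of the source -/

theorem integrableOn_sq_of_memLp_two {T : ℝ} {g : ℝ → ℝ}
    (hg : MemLp g 2 (volume.restrict (Ioo 0 T))) :
    IntegrableOn (fun t => g t ^ 2) (Ioo 0 T) := hg.integrable_sq

/-- Cauchy–Schwarz in Young's form with weight `s = τ^{-1/2}`: `2x|g| ≤ x²/s + s g²` for `x =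
e^{-τt} ≤ 1`, and `∫ x² ≤ ∫ x ≤ s²`. -/
theorem abs_laplace_le_of_memLp_two {T : ℝ} (hT : 0 ≤ T) {g : ℝ → ℝ}
    (hg : MemLp g 2 (volume.restrict (Ioo 0 T))) :
    ∃ C : ℝ, ∀ τ : ℝ, 0 < τ →
      |∫ t in Ioo 0 T, Real.exp (-(τ * t)) * g t| ≤ C * τ ^ (-(1 / 2) : ℝ) := by
  refine ⟨1 + ∫ t in Ioo 0 T, g t ^ 2, fun τ hτ => ?_⟩
  set s : ℝ := τ ^ (-(1 / 2) : ℝ) with hs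
  have hs0 : 0 < s := Real.rpow_pos_of_pos hτ _
  have hss : s * s = τ⁻¹ := by
    rw [hs, ← Real.rpow_add hτ, ← Real.rpow_neg_one]; norm_num
  have hi1 : IntegrableOn (fun t => Real.exp (-(τ * t))) (Ioo 0 T) := by
    have h1 : IntegrableOn (fun _ : ℝ => (1 : ℝ)) (Ioo 0 T) := by simp
    simpa using integrableOn_Ioo_mul_of_continuous
      (by fun_prop : Continuous fun t => Real.exp (-(τ * t))) h1
  have hi2 := integrableOn_sq_of_memLp_two hg
  have hle : ∫ t in Ioo 0 T, |Real.exp (-(τ * t)) * g t| ≤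
      ∫ t in Ioo 0 T, (s⁻¹ * Real.exp (-(τ * t)) + s * g t ^ 2) := by
    refine integral_mono_of_nonneg (Eventually.of_forall fun _ => abs_nonneg _)
      ((hi1.const_mul _).add (hi2.const_mul _)) ?_
    filter_upwards [ae_restrict_mem measurableSet_Ioo] with t ht
    have hx1 : Real.exp (-(τ * t)) ≤ 1 := Real.exp_le_one_iff.2 (by nlinarith [ht.1])
    have hx0 := Real.exp_pos (-(τ * t))
    set x := Real.exp (-(τ * t))
    rw [abs_mul, abs_of_pos hx0]
    have hsi : s⁻¹ * s = 1 := inv_mul_cancel₀ hs0.ne'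
    have hsi0 : 0 < s⁻¹ := inv_pos.2 hs0
    have key : 2 * (x * |g t|) ≤ s⁻¹ * x ^ 2 + s * |g t| ^ 2 := by
      have : 0 ≤ s⁻¹ * (x - s * |g t|) ^ 2 := by positivity
      have e : s⁻¹ * (x - s * |g t|) ^ 2 = s⁻¹ * x ^ 2 - 2 * (s⁻¹ * s) * (x * |g t|)
        + (s⁻¹ * s) * s * |g t| ^ 2 := by ring
      rw [e, hsi] at this
      linarith
    rw [sq_abs] at key
    have : s⁻¹ * x ^ 2 ≤ s⁻¹ * x := by gcongr; nlinarith
    have : 0 ≤ x * |g t| := by positivity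
    linarith
  refine (abs_integral_le_integral_abs).trans (hle.trans ?_)
  rw [integral_add (hi1.const_mul _) (hi2.const_mul _), integral_const_mul, integral_const_mul]
  have h1 := integral_exp_Ioo hT τ
  have h2 : ∫ t in Ioo 0 T, Real.exp (-(τ * t)) ≤ s * s := by
    rw [hss, ← mul_le_mul_iff_right₀ hτ, mul_inv_cancel₀ hτ.ne']
    linarith [Real.exp_pos (-(τ * T))]
  have h3 : s⁻¹ * ∫ t in Ioo 0 T, Real.exp (-(τ * t)) ≤ s⁻¹ * (s * s) := by gcongr
  rw [inv_mul_cancel_left₀ hs0.ne'] at h3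
  linarith

/-- A smooth cut-off function which vanishes on `(-∞, δ]` and equals `1` on `[2 * δ, ∞)`. -/
noncomputable def startCutoff (δ t : ℝ) : ℝ := Real.smoothTransition ((t - δ) / δ)

theorem contDiff_startCutoff (δ : ℝ) : ContDiff ℝ ∞ (startCutoff δ) :=
  Real.smoothTransition.contDiff.comp (by fun_prop)

theorem startCutoff_eq_one {δ t : ℝ} (hδ : 0 < δ) (ht : 2 * δ ≤ t) : startCutoff δ t = 1 :=
  Real.smoothTransition.one_of_one_le ((one_le_div hδ).2 (by linarith))

theorem startCutoff_eq_zero {δ t : ℝ} (hδ : 0 < δ) (ht : t ≤ δ) : startCutoff δ t = 0 :=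
  Real.smoothTransition.zero_of_nonpos (div_nonpos_of_nonpos_of_nonneg (by linarith) hδ.le)

theorem deriv_startCutoff_nonneg {δ : ℝ} (hδ : 0 < δ) (t : ℝ) : 0 ≤ deriv (startCutoff δ) t := by
  have : Monotone (startCutoff δ) := fun x y hxy =>
    Real.smoothTransition.monotone (by gcongr)
  exact this.deriv_nonneg

theorem deriv_startCutoff_eq_zero {δ t : ℝ} (hδ : 0 < δ) (ht : 2 * δ < t) :
    deriv (startCutoff δ) t = 0 := by
  have : startCutoff δ =ᶠ[nhds t] fun _ => 1 := by
    filter_upwards [Ioi_mem_nhds ht] with s hs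
    exact startCutoff_eq_one hδ hs.le
  rw [this.deriv_eq, deriv_const]

theorem tsupport_startCutoff_subset {δ : ℝ} (hδ : 0 < δ) : tsupport (startCutoff δ) ⊆ Ioi 0 := by
  have h : tsupport (startCutoff δ) ⊆ Ici δ :=
    closure_minimal (fun t ht => by
      by_contra h
      exact ht (startCutoff_eq_zero hδ (not_le.1 h).le)) isClosed_Ici
  exact h.trans fun t ht => lt_of_lt_of_le hδ ht

/-- A function of `H¹(0, T)` which vanishes at `0` can be tested against functions which need not
vanish at `0`. -/
theorem weakDeriv_of_apply_zero {T : ℝ} (hT : 0 < T) {f g : ℝ → ℝ}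
    (hf : ContinuousOn f (Icc 0 T)) (hf0 : f 0 = 0) (hg : IntegrableOn g (Ioo 0 T))
    (h : ∀ ψ : ℝ → ℝ, ContDiff ℝ ∞ ψ → HasCompactSupport ψ → tsupport ψ ⊆ Ioo 0 T →
        ∫ t in Ioo 0 T, f t * deriv ψ t = - ∫ t in Ioo 0 T, g t * ψ t)
    (ψ : ℝ → ℝ) (hψ : ContDiff ℝ ∞ ψ) (hψc : HasCompactSupport ψ) (hψT : tsupport ψ ⊆ Iio T) :
    - ∫ t in Ioo 0 T, deriv ψ t * f t = ∫ t in Ioo 0 T, ψ t * g t := by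
  have hfi : IntegrableOn f (Ioo 0 T) :=
    (hf.integrableOn_compact isCompact_Icc).mono_set Ioo_subset_Icc_self
  set δ : ℕ → ℝ := fun n => T / (n + 2) with hδdef
  have hδ : ∀ n, 0 < δ n := fun n => by simp only [hδdef]; positivity
  have hδT : ∀ n, 2 * δ n ≤ T := fun n => by
    have : T / ((n : ℝ) + 2) ≤ T / 2 := by gcongr; linarith [n.cast_nonneg (α := ℝ)]
    simp only [hδdef]; linarith
  have hδ0 : Tendsto (fun n => 2 * δ n) atTop (nhds 0) := by
    have := (tendsto_const_nhds (x := T)).div_atTop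
      (tendsto_natCast_atTop_atTop.atTop_add (tendsto_const_nhds (x := (2 : ℝ))))
    simpa using this.const_mul 2
  have hθs : ∀ n, ContDiff ℝ ∞ (startCutoff (δ n)) := fun n => contDiff_startCutoff _
  have hlim : ∀ k : ℝ → ℝ, IntegrableOn k (Ioo 0 T) →
      Tendsto (fun n => ∫ t in Ioo 0 T, startCutoff (δ n) t * k t) atTop
        (nhds (∫ t in Ioo 0 T, k t)) := by
    intro k hk
    refine tendsto_integral_of_dominated_convergence (fun t => |k t|)
      (fun n => ((hθs n).continuous.aestronglyMeasurable.mul hk.1)) hk.abs ?_ ?_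
    · intro n
      refine Eventually.of_forall fun t => ?_
      rw [norm_mul, Real.norm_eq_abs, Real.norm_eq_abs, startCutoff,
        abs_of_nonneg (Real.smoothTransition.nonneg _)]
      exact mul_le_of_le_one_left (abs_nonneg _) (Real.smoothTransition.le_one _)
    · filter_upwards [ae_restrict_mem measurableSet_Ioo] with t ht
      refine tendsto_const_nhds.congr' ?_
      filter_upwards [hδ0.eventually (gt_mem_nhds ht.1)] with n hn
      rw [startCutoff_eq_one (hδ n) hn.le, one_mul]
  obtain ⟨M, hM⟩ := isCompact_Icc.exists_bound_of_continuousOn (s := Icc 0 T) hψ.continuous.continuousOn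
  have hM0 : 0 ≤ M := (norm_nonneg _).trans (hM 0 ⟨le_rfl, hT.le⟩)
  have hiψ' : IntegrableOn (fun t => deriv ψ t * f t) (Ioo 0 T) :=
    integrableOn_Ioo_mul_of_continuous (hψ.continuous_deriv (by simp)) hfi
  have hiψ : IntegrableOn (fun t => ψ t * f t) (Ioo 0 T) :=
    integrableOn_Ioo_mul_of_continuous hψ.continuous hfi
  have hib : ∀ n, IntegrableOn (fun t => deriv (startCutoff (δ n)) t * (ψ t * f t)) (Ioo 0 T) :=
    fun n => integrableOn_Ioo_mul_of_continuous ((hθs n).continuous_deriv (by simp)) hiψ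
  -- The derivative of the cut-off is nonnegative with mass `1`, concentrated on `t ≤ 2δ`, where `f`
  -- is small because it is continuous and `f 0 = 0`.
  have hzero : Tendsto (fun n => ∫ t in Ioo 0 T, deriv (startCutoff (δ n)) t * (ψ t * f t)) atTop
      (nhds 0) := by
    rw [Metric.tendsto_atTop']
    intro ε hε
    have hc : ContinuousWithinAt f (Icc 0 T) 0 := hf 0 ⟨le_rfl, hT.le⟩
    obtain ⟨r, hr, hfr⟩ := Metric.continuousWithinAt_iff.1 hc (ε / (M + 1)) (by positivity)
    obtain ⟨N, hN⟩ := eventually_atTop.1 (hδ0.eventually (gt_mem_nhds hr))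
    refine ⟨N, fun n hn => ?_⟩
    have hnr := hN n hn.le
    rw [dist_zero_right, Real.norm_eq_abs]
    have hint : ∫ t in Ioo 0 T, deriv (startCutoff (δ n)) t = 1 := by
      rw [integral_deriv_Ioo (hθs n) hT.le, startCutoff_eq_one (hδ n) (hδT n),
        startCutoff_eq_zero (hδ n) (hδ n).le, sub_zero]
    have hi1 : IntegrableOn (fun _ : ℝ => (1 : ℝ)) (Ioo 0 T) := by simp
    calc |∫ t in Ioo 0 T, deriv (startCutoff (δ n)) t * (ψ t * f t)|
        ≤ ∫ t in Ioo 0 T, |deriv (startCutoff (δ n)) t * (ψ t * f t)| :=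
          abs_integral_le_integral_abs
      _ ≤ ∫ t in Ioo 0 T, (M * (ε / (M + 1))) * deriv (startCutoff (δ n)) t := by
          refine integral_mono_ae (hib n).abs ?_ ?_
          · simpa using! (integrableOn_Ioo_mul_of_continuous
              ((hθs n).continuous_deriv (by simp)) hi1).const_mul (M * (ε / (M + 1)))
          · filter_upwards [ae_restrict_mem measurableSet_Ioo] with t ht
            have hd := deriv_startCutoff_nonneg (hδ n) t
            rw [abs_mul, abs_of_nonneg hd]
            rcases le_or_gt t (2 * δ n) with h2 | h2
            · rw [mul_comm]
              refine mul_le_mul_of_nonneg_right ?_ hd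
              rw [abs_mul]
              have h3 := hM t (Ioo_subset_Icc_self ht)
              have h4 := hfr (Ioo_subset_Icc_self ht) (by
                rw [dist_zero_right, Real.norm_eq_abs, abs_of_pos ht.1]; linarith)
              rw [hf0, dist_zero_right, Real.norm_eq_abs] at h4
              exact mul_le_mul h3 h4.le (abs_nonneg _) hM0
            · rw [deriv_startCutoff_eq_zero (hδ n) h2]; simp
      _ = M * (ε / (M + 1)) := by rw [integral_const_mul, hint, mul_one]
      _ < ε := by
          rw [← mul_div_assoc, div_lt_iff₀ (by positivity)]
          nlinarith
  have hid : ∀ n, - ((∫ t in Ioo 0 T, startCutoff (δ n) t * (deriv ψ t * f t))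
      + ∫ t in Ioo 0 T, deriv (startCutoff (δ n)) t * (ψ t * f t))
      = ∫ t in Ioo 0 T, startCutoff (δ n) t * (ψ t * g t) := by
    intro n
    have h1 := h (fun t => startCutoff (δ n) t * ψ t) ((hθs n).mul hψ) hψc.mul_left
      (fun t ht => ⟨tsupport_startCutoff_subset (hδ n) (tsupport_mul_subset_left ht),
        hψT (tsupport_mul_subset_right ht)⟩)
    rw [← integral_add (integrableOn_Ioo_mul_of_continuous (hθs n).continuous hiψ') (hib n),
      neg_eq_iff_eq_neg]
    have h2 : ∀ t, deriv (fun t => startCutoff (δ n) t * ψ t) t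
        = deriv (startCutoff (δ n)) t * ψ t + startCutoff (δ n) t * deriv ψ t := fun t =>
      deriv_fun_mul ((hθs n).differentiable (by simp) t) (hψ.differentiable (by simp) t)
    simp_rw [h2] at h1
    refine Eq.trans ?_ (h1.trans ?_)
    · exact integral_congr_ae (Eventually.of_forall fun t => by ring)
    · exact congrArg Neg.neg (integral_congr_ae (Eventually.of_forall fun t => by ring))
  have hl := ((hlim _ hiψ').add hzero).neg
  rw [add_zero] at hl
  exact tendsto_nhds_unique (hl.congr hid)
    (hlim _ (integrableOn_Ioo_mul_of_continuous hψ.continuous hg))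

/-- Lets the exponentially small boundary terms be absorbed into the rate `τ^{-3/2}` of the source.
-/
theorem exp_neg_mul_le_rpow {T : ℝ} (hT : 0 < T) {τ : ℝ} (hτ : 1 ≤ τ) :
    Real.exp (-(τ * T)) ≤ 2 / T ^ 2 * τ ^ (-(3 / 2) : ℝ) := by
  have hτ0 : 0 < τ := by linarith
  have h1 : (τ * T) ^ 2 / 2 ≤ Real.exp (τ * T) := by
    have := Real.quadratic_le_exp_of_nonneg (mul_pos hτ0 hT).le
    have : 0 < τ * T := by positivity
    linarith
  have h2 : τ ^ (-2 : ℝ) ≤ τ ^ (-(3 / 2) : ℝ) :=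
    Real.rpow_le_rpow_of_exponent_le hτ (by norm_num)
  calc Real.exp (-(τ * T)) ≤ ((τ * T) ^ 2 / 2)⁻¹ := by
        rw [Real.exp_neg]
        exact inv_anti₀ (by positivity) h1
    _ = 2 / T ^ 2 * τ ^ (-2 : ℝ) := by
        rw [Real.rpow_neg hτ0.le, Real.rpow_two]
        field_simp
    _ ≤ _ := by gcongr

/-- The truncated Laplace transform of a function of `H¹(0, T)` which vanishes at `0`. -/
theorem MemH1.abs_laplace_le {T : ℝ} (hT : 0 < T) {f : ℝ → ℝ} (hf : MemH1 T f) (hf0 : f 0 = 0) :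
    ∃ C : ℝ, 0 ≤ C ∧ ∀ τ : ℝ, 1 ≤ τ →
      |∫ t in Ioo 0 T, Real.exp (-(τ * t)) * f t| ≤ C * τ ^ (-(3 / 2) : ℝ) := by
  obtain ⟨hfc, g, hg, hfg⟩ := hf
  have hgi : IntegrableOn g (Ioo 0 T) := hg.integrable (by norm_num)
  have hfi : IntegrableOn f (Ioo 0 T) :=
    (hfc.integrableOn_compact isCompact_Icc).mono_set Ioo_subset_Icc_self
  obtain ⟨K, hK⟩ := isCompact_Icc.exists_bound_of_continuousOn hfc
  obtain ⟨C, hC⟩ := abs_laplace_le_of_memLp_two hT.le hg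
  refine ⟨max C 0 + max K 0 * (2 / T ^ 2), by positivity, fun τ hτ => ?_⟩
  have hτ0 : 0 < τ := by linarith
  have h1 := abs_laplace_weakDeriv_sub_le hT (K := K) hfi hgi (by
    filter_upwards [ae_restrict_mem measurableSet_Ioo] with t ht
    exact hK t (Ioo_subset_Icc_self ht)) (weakDeriv_of_apply_zero hT hfc hf0 hgi hfg) τ
  have h2 := hC τ hτ0
  set x := ∫ t in Ioo 0 T, Real.exp (-(τ * t)) * f t
  set y := ∫ t in Ioo 0 T, Real.exp (-(τ * t)) * g t
  set w := Real.exp (-(τ * T))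
  have hw : 0 < w := Real.exp_pos _
  have hpow : τ ^ (-(1 / 2) : ℝ) = τ * τ ^ (-(3 / 2) : ℝ) := by
    rw [mul_comm, ← Real.rpow_add_one hτ0.ne']; norm_num
  rw [hpow] at h2
  have hp : 0 < τ ^ (-(3 / 2) : ℝ) := Real.rpow_pos_of_pos hτ0 _
  set q := τ ^ (-(3 / 2) : ℝ)
  have h3 : |τ * x| ≤ |y| + |y - τ * x| := by
    have := abs_sub y (y - τ * x)
    rwa [sub_sub_cancel] at this
  rw [abs_mul, abs_of_pos hτ0] at h3
  have h4 : C * (τ * q) ≤ τ * (max C 0 * q) := by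
    nlinarith [mul_le_mul_of_nonneg_right (le_max_left C 0) (mul_pos hτ0 hp).le]
  have h5 : K * w ≤ τ * (max K 0 * w) := by
    have a1 := mul_le_mul_of_nonneg_right (le_max_left K 0) hw.le
    have a2 : 0 ≤ max K 0 * w := by positivity
    nlinarith
  have h6 : τ * |x| ≤ τ * (max C 0 * q + max K 0 * w) := by linarith
  have h7 := le_of_mul_le_mul_left h6 hτ0
  calc |x| ≤ max C 0 * q + max K 0 * w := h7
    _ ≤ max C 0 * q + max K 0 * (2 / T ^ 2 * q) := by
        gcongr
        exact exp_neg_mul_le_rpow hT hτ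
    _ = _ := by ring

/-! ### Weighted pairings in `L²` -/

/-- Multiplication of a square-integrable field by an essentially bounded function. -/
noncomputable def mulField {c : E3 → ℝ} (hc : MemLp c ⊤ volume) (u : L2Field) : L2Field :=
  ((Lp.memLp u).smul hc : MemLp (c • (u : E3 → E3)) 2 volume).toLp

theorem coeFn_mulField {c : E3 → ℝ} (hc : MemLp c ⊤ volume) (u : L2Field) :
    ∀ᵐ x, mulField hc u x = c x • u x :=
  MemLp.coeFn_toLp _

theorem norm_mulField_le {c : E3 → ℝ} (hc : MemLp c ⊤ volume) (u : L2Field) :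
    ‖mulField hc u‖ ≤ (eLpNorm c ⊤ volume).toReal * ‖u‖ := by
  rw [mulField, Lp.norm_toLp, Lp.norm_def, ← ENNReal.toReal_mul]
  exact ENNReal.toReal_mono (ENNReal.mul_ne_top hc.eLpNorm_ne_top (Lp.eLpNorm_ne_top u))
    (eLpNorm_smul_le_eLpNorm_top_mul_eLpNorm 2 (Lp.aestronglyMeasurable u) c)

/-- The weighted pairing `∫ c u · v` of two vector fields. -/
noncomputable def weightedInner (c : E3 → ℝ) (u v : L2Field) : ℝ :=
  ∫ x, c x * inner ℝ (u x) (v x)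

theorem inner_mulField_left {c : E3 → ℝ} (hc : MemLp c ⊤ volume) (u v : L2Field) :
    inner ℝ (mulField hc u) v = weightedInner c u v := by
  rw [L2.inner_def]
  refine integral_congr_ae ?_
  filter_upwards [coeFn_mulField hc u] with x hx
  rw [hx, real_inner_smul_left]

theorem weightedInner_comm (c : E3 → ℝ) (u v : L2Field) :
    weightedInner c u v = weightedInner c v u := by
  simp only [weightedInner, real_inner_comm]

theorem inner_mulField_right {c : E3 → ℝ} (hc : MemLp c ⊤ volume) (u v : L2Field) :
    inner ℝ u (mulField hc v) = weightedInner c u v := by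
  rw [real_inner_comm, inner_mulField_left, weightedInner_comm]

theorem integrable_weightedInner {c : E3 → ℝ} (hc : MemLp c ⊤ volume) (u v : L2Field) :
    Integrable (fun x => c x * inner ℝ (u x) (v x)) := by
  refine (L2.integrable_inner (𝕜 := ℝ) (mulField hc u) v).congr ?_
  filter_upwards [coeFn_mulField hc u] with x hx
  rw [hx, real_inner_smul_left]

theorem le_weightedInner_self {c : E3 → ℝ} (hc : MemLp c ⊤ volume) {k : ℝ}
    (hk : ∀ᵐ x, k ≤ c x) (u : L2Field) : k * ‖u‖ ^ 2 ≤ weightedInner c u u := by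
  rw [← real_inner_self_eq_norm_sq, L2.inner_def, ← integral_const_mul]
  refine integral_mono_ae ((L2.integrable_inner (𝕜 := ℝ) u u).const_mul k)
    (integrable_weightedInner hc u u) ?_
  filter_upwards [hk] with x hx
  exact mul_le_mul_of_nonneg_right hx real_inner_self_nonneg

/-- Integrated form of `c |u - (d / c) v|² ≥ 0`. -/
theorem two_mul_weightedInner_le {c d k : E3 → ℝ} (hc : MemLp c ⊤ volume)
    (hd : MemLp d ⊤ volume) (hk : MemLp k ⊤ volume) (hpos : ∀ᵐ x, 0 < c x)
    (hkc : ∀ᵐ x, k x * c x = d x ^ 2) (u v : L2Field) :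
    2 * weightedInner d u v ≤ weightedInner c u u + weightedInner k v v := by
  unfold weightedInner
  rw [← integral_const_mul,
    ← integral_add (integrable_weightedInner hc u u) (integrable_weightedInner hk v v)]
  refine integral_mono_ae ((integrable_weightedInner hd u v).const_mul 2)
    ((integrable_weightedInner hc u u).add (integrable_weightedInner hk v v)) ?_
  filter_upwards [hpos, hkc] with x hx hkx
  -- Expanding `|c u - d v|² ≥ 0` avoids the quotient `d / c`; one factor `c` is cancelled
  -- afterwards.
  have h := real_inner_self_nonneg (x := c x • u x - d x • v x)
  rw [inner_sub_left, inner_sub_right, inner_sub_right, real_inner_smul_left, real_inner_smul_left,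
    real_inner_smul_left, real_inner_smul_left, real_inner_smul_right, real_inner_smul_right,
    real_inner_smul_right, real_inner_smul_right, real_inner_comm (u x) (v x)] at h
  refine le_of_mul_le_mul_left ?_ hx
  have e : d x * (d x * inner ℝ (v x) (v x)) = k x * c x * inner ℝ (v x) (v x) := by
    rw [hkx]; ring
  rw [e] at h
  linarith

/-! ### The weak curl -/

section Curl

theorem partialDeriv_eq_fderiv_coord {φ : E3 → E3} (hφ : Differentiable ℝ φ) (i j : Fin 3)
    (x : E3) : partialDeriv i j φ x
      = fderiv ℝ (fun y => φ y j) x (EuclideanSpace.single i 1) := by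
  have h : (fun y => φ y j) = (EuclideanSpace.proj j : E3 →L[ℝ] ℝ) ∘ φ := rfl
  rw [h, ((EuclideanSpace.proj j : E3 →L[ℝ] ℝ).hasFDerivAt.comp x (hφ x).hasFDerivAt).fderiv]
  rfl

theorem continuous_partialDeriv {φ : E3 → E3} (hφ : ContDiff ℝ ∞ φ) (i j : Fin 3) :
    Continuous (partialDeriv i j φ) := by
  have : Continuous fun x => fderiv ℝ φ x (EuclideanSpace.single i 1) :=
    (hφ.continuous_fderiv (by simp)).clm_apply continuous_const
  exact (EuclideanSpace.proj j : E3 →L[ℝ] ℝ).continuous.comp this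

theorem hasCompactSupport_partialDeriv {φ : E3 → E3} (hφ : HasCompactSupport φ) (i j : Fin 3) :
    HasCompactSupport (partialDeriv i j φ) :=
  (hφ.fderiv ℝ).comp_left (g := fun L : E3 →L[ℝ] E3 => L (EuclideanSpace.single i 1) j) rfl

theorem hasCompactSupport_coord {φ : E3 → E3} (hφ : HasCompactSupport φ) (i : Fin 3) :
    HasCompactSupport fun x => φ x i :=
  hφ.comp_left (g := fun v : E3 => v i) rfl

theorem continuous_coord {φ : E3 → E3} (hφ : Continuous φ) (i : Fin 3) :
    Continuous fun x => φ x i :=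
  (EuclideanSpace.proj i : E3 →L[ℝ] ℝ).continuous.comp hφ

theorem integral_mul_partialDeriv {φ ψ : E3 → E3} (hφ : ContDiff ℝ ∞ φ)
    (hφc : HasCompactSupport φ) (hψ : ContDiff ℝ ∞ ψ) (i j k : Fin 3) :
    ∫ x, φ x k * partialDeriv i j ψ x = - ∫ x, partialDeriv i k φ x * ψ x j := by
  have hφd := hφ.differentiable (by simp)
  have hψd := hψ.differentiable (by simp)
  have h1 := (continuous_coord hφ.continuous k).mul (continuous_partialDeriv hψ i j)
  have h2 := (continuous_partialDeriv hφ i k).mul (continuous_coord hψ.continuous j)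
  have h3 := (continuous_coord hφ.continuous k).mul (continuous_coord hψ.continuous j)
  have i1 : Integrable fun x => φ x k * partialDeriv i j ψ x :=
    h1.integrable_of_hasCompactSupport (hasCompactSupport_coord hφc k).mul_right
  have i2 : Integrable fun x => partialDeriv i k φ x * ψ x j :=
    h2.integrable_of_hasCompactSupport (hasCompactSupport_partialDeriv hφc i k).mul_right
  have i3 : Integrable fun x => φ x k * ψ x j :=
    h3.integrable_of_hasCompactSupport (hasCompactSupport_coord hφc k).mul_right
  simp_rw [partialDeriv_eq_fderiv_coord hφd, partialDeriv_eq_fderiv_coord hψd] at i1 i2 ⊢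
  exact integral_mul_fderiv_eq_neg_fderiv_mul_of_integrable i2 i1 i3
    (fun x _ => ((EuclideanSpace.proj k : E3 →L[ℝ] ℝ).differentiable.comp hφd) x)
    (fun x _ => ((EuclideanSpace.proj j : E3 →L[ℝ] ℝ).differentiable.comp hψd) x)

theorem inner_curl (v : E3) (φ : E3 → E3) (x : E3) :
    inner ℝ v (curl φ x) =
      v 0 * partialDeriv 1 2 φ x - v 0 * partialDeriv 2 1 φ x
      + (v 1 * partialDeriv 2 0 φ x - v 1 * partialDeriv 0 2 φ x)
      + (v 2 * partialDeriv 0 1 φ x - v 2 * partialDeriv 1 0 φ x) := by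
  rw [PiLp.inner_apply, Fin.sum_univ_three]
  simp only [curl, RCLike.inner_apply, conj_trivial]
  simp
  ring

theorem integral_inner_curl {φ ψ : E3 → E3} (hφ : ContDiff ℝ ∞ φ) (hφc : HasCompactSupport φ)
    (hψ : ContDiff ℝ ∞ ψ) :
    ∫ x, inner ℝ (φ x) (curl ψ x) =
      (∫ x, φ x 0 * partialDeriv 1 2 ψ x) - (∫ x, φ x 0 * partialDeriv 2 1 ψ x)
      + ((∫ x, φ x 1 * partialDeriv 2 0 ψ x) - ∫ x, φ x 1 * partialDeriv 0 2 ψ x)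
      + ((∫ x, φ x 2 * partialDeriv 0 1 ψ x) - ∫ x, φ x 2 * partialDeriv 1 0 ψ x) := by
  have hi : ∀ i j k, Integrable (fun x => φ x k * partialDeriv i j ψ x) := fun i j k =>
    ((continuous_coord hφ.continuous k).mul
      (continuous_partialDeriv hψ i j)).integrable_of_hasCompactSupport
      (hasCompactSupport_coord hφc k).mul_right
  simp_rw [inner_curl]
  rw [integral_add, integral_add, integral_sub (hi _ _ _) (hi _ _ _),
    integral_sub (hi _ _ _) (hi _ _ _), integral_sub (hi _ _ _) (hi _ _ _)]
  · exact (hi _ _ _).sub (hi _ _ _)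
  · exact (hi _ _ _).sub (hi _ _ _)
  · exact ((hi _ _ _).sub (hi _ _ _)).add ((hi _ _ _).sub (hi _ _ _))
  · exact (hi _ _ _).sub (hi _ _ _)

/-- The curl is a symmetric operator on test fields. -/
theorem integral_inner_curl_comm {φ ψ : E3 → E3} (hφ : ContDiff ℝ ∞ φ)
    (hφc : HasCompactSupport φ) (hψ : ContDiff ℝ ∞ ψ) (hψc : HasCompactSupport ψ) :
    ∫ x, inner ℝ (φ x) (curl ψ x) = ∫ x, inner ℝ (curl φ x) (ψ x) := by
  simp_rw [real_inner_comm (ψ _)]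
  rw [integral_inner_curl hφ hφc hψ, integral_inner_curl hψ hψc hφ]
  -- The minus sign from each integration by parts is compensated by the antisymmetry of the curl.
  simp_rw [integral_mul_partialDeriv hφ hφc hψ, mul_comm (partialDeriv _ _ φ _)]
  ring

theorem continuous_curl {φ : E3 → E3} (hφ : ContDiff ℝ ∞ φ) : Continuous (curl φ) := by
  have h := fun i j => continuous_partialDeriv hφ i j
  refine (PiLp.continuous_toLp 2 _).comp (continuous_pi fun i => ?_)
  fin_cases i
  · exact (h 1 2).sub (h 2 1)
  · exact (h 2 0).sub (h 0 2)
  · exact (h 0 1).sub (h 1 0)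

theorem hasCompactSupport_curl {φ : E3 → E3} (hφ : HasCompactSupport φ) :
    HasCompactSupport (curl φ) := by
  refine (hφ.fderiv ℝ).mono fun x hx h => hx ?_
  simp only [curl, partialDeriv, h]
  ext i
  fin_cases i <;> simp

/-- A test field, as an element of `L²`, has its classical curl as weak curl. -/
theorem exists_hasWeakCurl_of_contDiff {φ : E3 → E3} (hφ : ContDiff ℝ ∞ φ)
    (hφc : HasCompactSupport φ) :
    ∃ u w : L2Field, HasWeakCurl u w ∧ (∀ᵐ x, u x = φ x) ∧ ∀ᵐ x, w x = curl φ x := by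
  have h1 : MemLp φ 2 volume := hφ.continuous.memLp_of_hasCompactSupport hφc
  have h2 : MemLp (curl φ) 2 volume :=
    (continuous_curl hφ).memLp_of_hasCompactSupport (hasCompactSupport_curl hφc)
  refine ⟨h1.toLp, h2.toLp, fun ψ hψ hψc => ?_, h1.coeFn_toLp, h2.coeFn_toLp⟩
  have e1 : ∫ x, inner ℝ (h1.toLp φ x) (curl ψ x) = ∫ x, inner ℝ (φ x) (curl ψ x) :=
    integral_congr_ae (by filter_upwards [h1.coeFn_toLp] with x hx; rw [hx])
  have e2 : ∫ x, inner ℝ (h2.toLp (curl φ) x) (ψ x) = ∫ x, inner ℝ (curl φ x) (ψ x) :=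
    integral_congr_ae (by filter_upwards [h2.coeFn_toLp] with x hx; rw [hx])
  rw [e1, e2, integral_inner_curl_comm hφ hφc hψ hψc]

/-- To have a weak curl it is enough to satisfy Green's formula for all fields in `H(curl)`. -/
theorem hasWeakCurl_of_forall_inner {u w : L2Field}
    (h : ∀ Φ Ψ : L2Field, HasWeakCurl Φ Ψ → inner ℝ u Ψ = inner ℝ w Φ) : HasWeakCurl u w := by
  intro φ hφ hφc
  obtain ⟨Φ, Ψ, hΦΨ, hΦ, hΨ⟩ := exists_hasWeakCurl_of_contDiff hφ hφc
  have := h Φ Ψ hΦΨ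
  rw [L2.inner_def, L2.inner_def] at this
  refine Eq.trans ?_ (this.trans ?_)
  · exact integral_congr_ae (by filter_upwards [hΨ] with x hx; rw [hx])
  · exact integral_congr_ae (by filter_upwards [hΦ] with x hx; rw [hx])

/-- As an identity of inner products with fixed elements of `L²`, the condition is visibly linear in
`(u, w)`. -/
theorem hasWeakCurl_iff_inner {u w : L2Field} : HasWeakCurl u w ↔
    ∀ (φ : E3 → E3) (hφ : ContDiff ℝ ∞ φ) (hφc : HasCompactSupport φ),
      inner ℝ u (((continuous_curl hφ).memLp_of_hasCompactSupport (p := 2) (μ := volume)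
        (hasCompactSupport_curl hφc)).toLp) =
      inner ℝ w ((hφ.continuous.memLp_of_hasCompactSupport (p := 2) (μ := volume) hφc).toLp) := by
  refine forall_congr' fun φ => forall_congr' fun hφ => forall_congr' fun hφc => ?_
  rw [L2.inner_def, L2.inner_def]
  refine Eq.congr ?_ ?_
  · refine integral_congr_ae ?_
    filter_upwards [((continuous_curl hφ).memLp_of_hasCompactSupport (p := 2) (μ := volume)
      (hasCompactSupport_curl hφc)).coeFn_toLp] with x hx
    rw [hx]
  · refine integral_congr_ae ?_
    filter_upwards [(hφ.continuous.memLp_of_hasCompactSupport (p := 2) (μ := volume)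
      hφc).coeFn_toLp] with x hx
    rw [hx]

/-- The graph of the weak curl. -/
def weakCurlGraph : Submodule ℝ (L2Field × L2Field) where
  carrier := {p | HasWeakCurl p.1 p.2}
  zero_mem' := by
    simp only [mem_ofPred_eq, hasWeakCurl_iff_inner]
    intros
    simp only [Prod.fst_zero, Prod.snd_zero, inner_zero_left]
  add_mem' := fun {p q} hp hq => by
    simp only [mem_ofPred_eq, hasWeakCurl_iff_inner] at *
    intro φ hφ hφc
    simp only [Prod.fst_add, Prod.snd_add, inner_add_left, hp φ hφ hφc, hq φ hφ hφc]
  smul_mem' := fun r p hp => by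
    simp only [mem_ofPred_eq, hasWeakCurl_iff_inner] at *
    intro φ hφ hφc
    simp only [Prod.smul_fst, Prod.smul_snd, real_inner_smul_left, hp φ hφ hφc]

end Curl

/-! ### Residuals as elements of `L²` -/

/-- Riesz representation of a functional given on a linear relation which is bounded with respect
to the first component. -/
theorem exists_inner_eq_of_relation_bound {X : Type*} [NormedAddCommGroup X]
    [InnerProductSpace ℝ X] [CompleteSpace X] (S : Submodule ℝ (X × X)) (A B : X) {C : ℝ}
    (hC : 0 ≤ C) (h : ∀ p ∈ S, |inner ℝ A p.1 + inner ℝ B p.2| ≤ C * ‖p.1‖) :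
    ∃ F : X, ‖F‖ ≤ C ∧ ∀ p ∈ S, inner ℝ A p.1 + inner ℝ B p.2 = inner ℝ F p.1 := by
  set π : S →ₗ[ℝ] X := (LinearMap.fst ℝ X X).comp S.subtype with hπ
  set L : S →ₗ[ℝ] ℝ := ((innerₗ X A).comp (LinearMap.fst ℝ X X)
    + (innerₗ X B).comp (LinearMap.snd ℝ X X)).comp S.subtype with hL
  have hLa : ∀ p : S, L p = inner ℝ A p.1.1 + inner ℝ B p.1.2 := fun p => rfl
  -- The bound makes `L` vanish wherever the first component does, so `L` factors through that
  -- component; neither density nor single-valuedness of the relation is needed.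
  have hker : L ∈ (LinearMap.ker π).dualAnnihilator := by
    rw [Submodule.mem_dualAnnihilator]
    intro p hp
    have hp0 : p.1.1 = 0 := hp
    have := h p.1 p.2
    rw [hp0, norm_zero, mul_zero] at this
    rw [hLa, hp0]
    exact abs_nonpos_iff.1 this
  rw [← LinearMap.range_dualMap_eq_dualAnnihilator_ker] at hker
  obtain ⟨l, hl⟩ := hker
  have hl' : ∀ p : S, l p.1.1 = L p := fun p => LinearMap.congr_fun hl p
  -- `l` is merely an algebraic functional on `X`. It is bounded on the range of `π`, from which
  -- Hahn–Banach extends it with the same norm.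
  set R : Submodule ℝ X := LinearMap.range π
  have hbd : ∀ y : R, ‖(l.comp R.subtype) y‖ ≤ C * ‖y‖ := by
    rintro ⟨_, p, rfl⟩
    change |l p.1.1| ≤ C * ‖p.1.1‖
    rw [hl', hLa]
    exact h p.1 p.2
  obtain ⟨g, hg, hgn⟩ := exists_extension_norm_eq R ((l.comp R.subtype).mkContinuous C hbd)
  refine ⟨(InnerProductSpace.toDual ℝ X).symm g, ?_, fun p hp => ?_⟩
  · rw [LinearIsometryEquiv.norm_map, hgn]
    exact LinearMap.mkContinuous_norm_le _ hC _
  · rw [InnerProductSpace.toDual_symm_apply]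
    have := hg ⟨p.1, ⟨⟨p, hp⟩, rfl⟩⟩
    rw [this]
    exact (hl' ⟨p, hp⟩).symm

/-! ### Transforms of fields and of the source -/

section Laplace

variable {T : ℝ} {F : ℝ → L2Field}

theorem integrableOn_exp_mul {b : ℝ → ℝ} (hb : IntegrableOn b (Ioo 0 T)) (τ : ℝ) :
    IntegrableOn (fun t => Real.exp (-(τ * t)) * b t) (Ioo 0 T) :=
  integrableOn_Ioo_mul_of_continuous (by fun_prop) hb

theorem integrableOn_exp_smul (hF : MemLp F ⊤ (volume.restrict (Ioo 0 T))) (τ : ℝ) :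
    IntegrableOn (fun t => Real.exp (-(τ * t)) • F t) (Ioo 0 T) := by
  have hi : IntegrableOn F (Ioo 0 T) := hF.integrable le_top
  obtain ⟨C, hC⟩ := isCompact_Icc.exists_bound_of_continuousOn (s := Icc 0 T)
    (f := fun t => Real.exp (-(τ * t))) (by fun_prop)
  refine Integrable.bdd_smul hi C
    (by fun_prop : Continuous fun t => Real.exp (-(τ * t))).aestronglyMeasurable ?_
  filter_upwards [ae_restrict_mem measurableSet_Ioo] with t ht
  exact hC t (Ioo_subset_Icc_self ht)

theorem integrableOn_inner_const (hF : MemLp F ⊤ (volume.restrict (Ioo 0 T))) (v : L2Field) :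
    IntegrableOn (fun t => inner ℝ (F t) v) (Ioo 0 T) :=
  (hF.integrable le_top).inner_const v

theorem inner_laplaceField (hF : MemLp F ⊤ (volume.restrict (Ioo 0 T))) (τ : ℝ) (v : L2Field) :
    inner ℝ (laplaceField T F τ) v = ∫ t in Ioo 0 T, Real.exp (-(τ * t)) * inner ℝ (F t) v := by
  rw [real_inner_comm, laplaceField, ← integral_inner (integrableOn_exp_smul hF τ)]
  refine integral_congr_ae (Eventually.of_forall fun t => ?_)
  simp only [real_inner_smul_right, real_inner_comm]

theorem exists_norm_le_of_memLp_top (hF : MemLp F ⊤ (volume.restrict (Ioo 0 T))) :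
    ∃ K : ℝ, 0 ≤ K ∧ ∀ᵐ t ∂volume.restrict (Ioo 0 T), ‖F t‖ ≤ K := by
  refine ⟨(eLpNorm F ⊤ (volume.restrict (Ioo 0 T))).toReal, ENNReal.toReal_nonneg, ?_⟩
  filter_upwards [ae_le_eLpNormEssSup (f := F) (μ := volume.restrict (Ioo 0 T))] with t ht
  rw [← eLpNorm_exponent_top] at ht
  have := ENNReal.toReal_mono hF.eLpNorm_ne_top ht
  simpa using this

end Laplace

/-- The square-integrable field `χ_B a` for a ball `B`. -/
noncomputable def ballField (p : E3) (η : ℝ) (a : E3) : L2Field :=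
  indicatorConstLp 2 (measurableSet_ball (x := p) (ε := η)) measure_ball_lt_top.ne a

theorem inner_ballField (p : E3) (η : ℝ) (a : E3) (v : L2Field) :
    inner ℝ (ballField p η a) v
      = ∫ x, inner ℝ ((Metric.ball p η).indicator (fun _ => a) x) (v x) := by
  rw [L2.inner_def]
  refine integral_congr_ae ?_
  have h : ballField p η a =ᵐ[volume] (Metric.ball p η).indicator fun _ => a :=
    indicatorConstLp_coeFn
  filter_upwards [h] with x hx
  rw [hx]

theorem integral_inner_currentDensity (f : ℝ → ℝ) (p : E3) (η : ℝ) (a : E3) (t : ℝ)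
    (v : L2Field) : ∫ x, inner ℝ (currentDensity f (Metric.ball p η) a t x) (v x)
      = f t * inner ℝ (ballField p η a) v := by
  rw [inner_ballField, ← integral_const_mul]
  simp only [currentDensity, real_inner_smul_left]

/-- The truncated Laplace transform of a scalar function. -/
noncomputable def laplaceScalar (T : ℝ) (f : ℝ → ℝ) (τ : ℝ) : ℝ :=
  ∫ t in Ioo 0 T, Real.exp (-(τ * t)) * f t

theorem laplaceSource_currentDensity (T : ℝ) (f : ℝ → ℝ) (B : Set E3) (a : E3) (τ : ℝ) (x : E3) :
    laplaceSource T (currentDensity f B a) τ x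
      = laplaceScalar T f τ • B.indicator (fun _ => a) x := by
  simp only [laplaceSource, currentDensity, smul_smul]
  rw [integral_smul_const, laplaceScalar]

theorem indicatorFunction_eq (T : ℝ) (f : ℝ → ℝ) (p : E3) (η : ℝ) (a : E3) (E E₀ : ℝ → L2Field)
    (τ : ℝ) : indicatorFunction T (currentDensity f (Metric.ball p η) a) E E₀ τ =
      laplaceScalar T f τ * inner ℝ (ballField p η a) (laplaceField T E τ)
      - laplaceScalar T f τ * inner ℝ (ballField p η a) (laplaceField T E₀ τ) := by
  rw [← mul_sub, ← inner_sub_right, inner_ballField, ← integral_const_mul, indicatorFunction]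
  refine integral_congr_ae ?_
  filter_upwards [Lp.coeFn_sub (laplaceField T E τ) (laplaceField T E₀ τ)] with x hx
  rw [laplaceSource_currentDensity, real_inner_smul_left, hx, Pi.sub_apply]

theorem memLp_effPermittivity {ε σ : E3 → ℝ} (hε : MemLp ε ⊤ volume) (hσ : MemLp σ ⊤ volume)
    (τ : ℝ) : MemLp (effPermittivity ε σ τ) ⊤ volume := by
  have h := hε.add (hσ.const_mul τ⁻¹)
  refine h.congr_norm (h.1.congr ?_) ?_ <;> refine Eventually.of_forall fun x => ?_ <;>
  simp [effPermittivity, div_eq_inv_mul]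

/-- The conduction term carries no time derivative, hence no factor `τ`; this identity merges it
with the permittivity. -/
theorem weightedInner_effPermittivity {ε σ : E3 → ℝ} (hε : MemLp ε ⊤ volume)
    (hσ : MemLp σ ⊤ volume) {τ : ℝ} (hτ : 0 < τ) (u v : L2Field) :
    τ * weightedInner (effPermittivity ε σ τ) u v
      = τ * weightedInner ε u v + weightedInner σ u v := by
  simp only [weightedInner]
  rw [← integral_const_mul, ← integral_const_mul, ← integral_add
    ((integrable_weightedInner hε u v).const_mul τ) (integrable_weightedInner hσ u v)]
  refine integral_congr_ae (Eventually.of_forall fun x => ?_)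
  simp only [effPermittivity]
  field_simp

/-! ### Maxwell's equations after the transform -/

namespace IsWeakMaxwellSolution

variable {T : ℝ} {ε μ σ : E3 → ℝ} {f : ℝ → ℝ} {p : E3} {η : ℝ} {a : E3} {E H : ℝ → L2Field}

/-- For fixed `Φ` the equation is a scalar one for `t ↦ ⟨εE(t), Φ⟩`, so
`abs_laplace_weakDeriv_sub_le` applies. Only the differentiated quantity enters its bound, so `‖Φ‖`
appears but `‖Ψ‖` does not; this is what allows the residual to be represented in `L²`. -/
theorem exists_abs_ampere_le (hT : 0 < T) (hmed : IsMedium ε μ σ)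
    (hf : IntegrableOn f (Ioo 0 T))
    (hEH : IsWeakMaxwellSolution T ε μ σ (currentDensity f (Metric.ball p η) a) E H) :
    ∃ C : ℝ, 0 ≤ C ∧ ∀ τ : ℝ, 0 < τ → ∀ Φ Ψ : L2Field, HasWeakCurl Φ Ψ →
      |inner ℝ (laplaceField T H τ) Ψ
        + laplaceScalar T f τ * inner ℝ (ballField p η a) Φ
        - τ * weightedInner (effPermittivity ε σ τ) (laplaceField T E τ) Φ|
        ≤ C * Real.exp (-(τ * T)) * ‖Φ‖ := by
  obtain ⟨K, hK0, hK⟩ := exists_norm_le_of_memLp_top hEH.electric_mem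
  have hε := hmed.permittivity_bdd
  have hσ := hmed.conductivity_bdd
  refine ⟨K * (eLpNorm ε ⊤ volume).toReal, by positivity, fun τ hτ Φ Ψ hΦ => ?_⟩
  set s := ballField p η a
  have iH := integrableOn_inner_const hEH.magnetic_mem Ψ
  have iσ := integrableOn_inner_const hEH.electric_mem (mulField hσ Φ)
  have iε := integrableOn_inner_const hEH.electric_mem (mulField hε Φ)
  have iJ : IntegrableOn (fun t => f t * inner ℝ s Φ) (Ioo 0 T) := hf.mul_const _
  have key := abs_laplace_weakDeriv_sub_le hT (b := fun t => inner ℝ (E t) (mulField hε Φ))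
    (g := fun t => inner ℝ (H t) Ψ - inner ℝ (E t) (mulField hσ Φ) + f t * inner ℝ s Φ)
    (K := K * ((eLpNorm ε ⊤ volume).toReal * ‖Φ‖)) iε ((iH.sub iσ).add iJ) (by
      filter_upwards [hK] with t ht
      refine (abs_real_inner_le_norm _ _).trans ?_
      exact mul_le_mul ht (norm_mulField_le hε Φ) (norm_nonneg _) hK0) (by
      intro ψ hψ hψc hψT
      have := hEH.ampere Φ Ψ hΦ ψ hψ hψc hψT
      simp_rw [integral_inner_currentDensity] at this
      simp_rw [inner_mulField_right, L2.inner_def]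
      exact this) τ
  have e1 : ∫ t in Ioo 0 T, Real.exp (-(τ * t)) *
      (inner ℝ (H t) Ψ - inner ℝ (E t) (mulField hσ Φ) + f t * inner ℝ s Φ)
      = inner ℝ (laplaceField T H τ) Ψ - inner ℝ (laplaceField T E τ) (mulField hσ Φ)
        + laplaceScalar T f τ * inner ℝ s Φ := by
    rw [inner_laplaceField hEH.magnetic_mem, inner_laplaceField hEH.electric_mem, laplaceScalar,
      ← integral_mul_const, ← integral_sub (integrableOn_exp_mul iH τ) (integrableOn_exp_mul iσ τ),
      ← integral_add]
    · exact integral_congr_ae (Eventually.of_forall fun t => by ring)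
    · exact (integrableOn_exp_mul iH τ).sub (integrableOn_exp_mul iσ τ)
    · exact (integrableOn_exp_mul hf τ).mul_const _
  rw [e1, ← inner_laplaceField hEH.electric_mem, inner_mulField_right, inner_mulField_right] at key
  rw [weightedInner_effPermittivity hε hσ hτ]
  calc _ = _ := by congr 1; ring
    _ ≤ _ := key
    _ = _ := by ring

theorem exists_abs_faraday_le (hT : 0 < T) (hmed : IsMedium ε μ σ)
    (hEH : IsWeakMaxwellSolution T ε μ σ (currentDensity f (Metric.ball p η) a) E H) :
    ∃ C : ℝ, 0 ≤ C ∧ ∀ τ : ℝ, ∀ Φ Ψ : L2Field, HasWeakCurl Φ Ψ →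
      |inner ℝ (laplaceField T E τ) Ψ + τ * weightedInner μ (laplaceField T H τ) Φ|
        ≤ C * Real.exp (-(τ * T)) * ‖Φ‖ := by
  obtain ⟨K, hK0, hK⟩ := exists_norm_le_of_memLp_top hEH.magnetic_mem
  have hμ := hmed.permeability_bdd
  refine ⟨K * (eLpNorm μ ⊤ volume).toReal, by positivity, fun τ Φ Ψ hΦ => ?_⟩
  have iE := integrableOn_inner_const hEH.electric_mem Ψ
  have iμ := integrableOn_inner_const hEH.magnetic_mem (mulField hμ Φ)
  have key := abs_laplace_weakDeriv_sub_le hT (b := fun t => inner ℝ (H t) (mulField hμ Φ))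
    (g := fun t => - inner ℝ (E t) Ψ)
    (K := K * ((eLpNorm μ ⊤ volume).toReal * ‖Φ‖)) iμ iE.neg (by
      filter_upwards [hK] with t ht
      refine (abs_real_inner_le_norm _ _).trans ?_
      exact mul_le_mul ht (norm_mulField_le hμ Φ) (norm_nonneg _) hK0) (by
      intro ψ hψ hψc hψT
      have := hEH.faraday Φ Ψ hΦ ψ hψ hψc hψT
      simp_rw [mul_neg, integral_neg, inner_mulField_right, L2.inner_def]
      exact this) τ
  simp_rw [mul_neg, integral_neg] at key
  rw [← inner_laplaceField hEH.electric_mem, ← inner_laplaceField hEH.magnetic_mem,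
    inner_mulField_right, ← neg_add', abs_neg] at key
  exact key.trans_eq (by ring)

end IsWeakMaxwellSolution

/-! ### The stationary system: reciprocity and energy -/

/-- `(W, V)` solves the stationary system `curl V = τ κ W - c s + F`, `curl W = -τ μ V + G` in the
sense that Green's formula holds against all fields of `H(curl)`. -/
structure IsStationarySolution (τ : ℝ) (κ μ : E3 → ℝ) (c : ℝ) (s F G W V : L2Field) : Prop where
  permittivity_bdd : MemLp κ ⊤ volume
  permeability_bdd : MemLp μ ⊤ volume
  ampere : ∀ Φ Ψ : L2Field, HasWeakCurl Φ Ψ →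
    inner ℝ V Ψ = τ * weightedInner κ W Φ - c * inner ℝ s Φ + inner ℝ F Φ
  faraday : ∀ Φ Ψ : L2Field, HasWeakCurl Φ Ψ →
    inner ℝ W Ψ = - (τ * weightedInner μ V Φ) + inner ℝ G Φ

namespace IsStationarySolution

variable {τ c : ℝ} {κ μ κ' μ' : E3 → ℝ} {s F G W V F' G' W' V' : L2Field}

/-- Makes the electric field of one solution admissible as a test field in the Ampère law of
another. -/
theorem hasWeakCurl_electric (h : IsStationarySolution τ κ μ c s F G W V) :
    HasWeakCurl W (-(τ • mulField h.permeability_bdd V) + G) :=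
  hasWeakCurl_of_forall_inner fun Φ Ψ hΦ => by
    rw [h.faraday Φ Ψ hΦ, inner_add_left, inner_neg_left, real_inner_smul_left,
      inner_mulField_left]

/-- Green's formula for a pair of solutions with the same source. -/
theorem reciprocity (h : IsStationarySolution τ κ μ c s F G W V)
    (h' : IsStationarySolution τ κ' μ' c s F' G' W' V') :
    τ * weightedInner κ W W' + τ * weightedInner μ' V V'
      = c * inner ℝ s W' - inner ℝ F W' + inner ℝ V G' := by
  have := h.ampere _ _ h'.hasWeakCurl_electric
  rw [inner_add_right, inner_neg_right, real_inner_smul_right, inner_mulField_right] at this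
  linarith

/-- The energy estimate. -/
theorem norm_add_norm_le (h : IsStationarySolution τ κ μ c s F G W V) (hτ : 0 < τ) {k K : ℝ}
    (hk : 0 < k) (hκ : ∀ᵐ x, k ≤ κ x) (hμ : ∀ᵐ x, k ≤ μ x) (hF : ‖F‖ ≤ K) (hG : ‖G‖ ≤ K) :
    ‖W‖ + ‖V‖ ≤ 2 * (|c| * ‖s‖ + K) / (k * τ) := by
  have h1 := h.reciprocity h
  have h2 := le_weightedInner_self h.permittivity_bdd hκ W
  have h3 := le_weightedInner_self h.permeability_bdd hμ V
  have h4 : c * inner ℝ s W ≤ |c| * ‖s‖ * ‖W‖ := by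
    refine (le_abs_self _).trans ?_
    rw [abs_mul, mul_assoc]
    exact mul_le_mul_of_nonneg_left (abs_real_inner_le_norm _ _) (abs_nonneg _)
  have h5 : - inner ℝ F W ≤ K * ‖W‖ :=
    (neg_le_abs _).trans ((abs_real_inner_le_norm _ _).trans (by gcongr))
  have h6 : inner ℝ V G ≤ ‖V‖ * K :=
    (real_inner_le_norm _ _).trans (by gcongr)
  have hc : 0 ≤ |c| * ‖s‖ := by positivity
  have hK : 0 ≤ K := (norm_nonneg F).trans hF
  have hW := norm_nonneg W
  have hV := norm_nonneg V
  -- The term `|c| ‖s‖ ‖V‖` is added on the right so that `‖W‖ + ‖V‖` factors out.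
  have h7 : τ * (k * ‖W‖ ^ 2) + τ * (k * ‖V‖ ^ 2) ≤ (|c| * ‖s‖ + K) * (‖W‖ + ‖V‖) := by
    have := mul_le_mul_of_nonneg_left h2 hτ.le
    have := mul_le_mul_of_nonneg_left h3 hτ.le
    have := mul_nonneg hc hV
    nlinarith
  rw [le_div_iff₀ (by positivity)]
  rcases (add_nonneg hW hV).eq_or_lt with h0 | h0
  · rw [← h0]; linarith
  · refine le_of_mul_le_mul_left ?_ h0
    -- Gives `(‖W‖ + ‖V‖)² ≤ 2(‖W‖² + ‖V‖²)`, the origin of the factor `2`.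
    have : 0 ≤ k * τ * (‖W‖ - ‖V‖) ^ 2 := by positivity
    nlinarith

end IsStationarySolution

/-- The truncated Laplace transforms of the fields solve the stationary system up to exponentially
small errors. -/
theorem IsWeakMaxwellSolution.exists_isStationarySolution {T : ℝ} {ε μ σ : E3 → ℝ} {f : ℝ → ℝ}
    {p : E3} {η : ℝ} {a : E3} {E H : ℝ → L2Field} (hT : 0 < T) (hmed : IsMedium ε μ σ)
    (hf : IntegrableOn f (Ioo 0 T))
    (hEH : IsWeakMaxwellSolution T ε μ σ (currentDensity f (Metric.ball p η) a) E H) :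
    ∃ C : ℝ, 0 ≤ C ∧ ∀ τ : ℝ, 0 < τ → ∃ F G : L2Field,
      ‖F‖ ≤ C * Real.exp (-(τ * T)) ∧ ‖G‖ ≤ C * Real.exp (-(τ * T)) ∧
      IsStationarySolution τ (effPermittivity ε σ τ) μ (laplaceScalar T f τ) (ballField p η a)
        F G (laplaceField T E τ) (laplaceField T H τ) := by
  obtain ⟨C₁, hC₁, h₁⟩ := hEH.exists_abs_ampere_le hT hmed hf
  obtain ⟨C₂, hC₂, h₂⟩ := hEH.exists_abs_faraday_le hT hmed
  refine ⟨max C₁ C₂, le_max_of_le_left hC₁, fun τ hτ => ?_⟩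
  have hκ := memLp_effPermittivity hmed.permittivity_bdd hmed.conductivity_bdd τ
  have hμ := hmed.permeability_bdd
  have hx := Real.exp_pos (-(τ * T))
  -- The functional is the defect `⟨cs - τκW, Φ⟩ + ⟨V, Ψ⟩` in the Ampère law; the next one is the
  -- defect in Faraday's law.
  obtain ⟨F, hF, hF'⟩ := exists_inner_eq_of_relation_bound weakCurlGraph
    (laplaceScalar T f τ • ballField p η a - τ • mulField hκ (laplaceField T E τ))
    (laplaceField T H τ) (C := C₁ * Real.exp (-(τ * T))) (by positivity) (by
      rintro ⟨Φ, Ψ⟩ hΦ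
      have := h₁ τ hτ Φ Ψ hΦ
      rw [inner_sub_left, real_inner_smul_left, real_inner_smul_left, inner_mulField_left]
      refine Eq.trans_le ?_ this
      congr 1; ring)
  obtain ⟨G, hG, hG'⟩ := exists_inner_eq_of_relation_bound weakCurlGraph
    (τ • mulField hμ (laplaceField T H τ))
    (laplaceField T E τ) (C := C₂ * Real.exp (-(τ * T))) (by positivity) (by
      rintro ⟨Φ, Ψ⟩ hΦ
      have := h₂ τ Φ Ψ hΦ
      rw [real_inner_smul_left, inner_mulField_left, add_comm]
      exact this)
  refine ⟨F, G, hF.trans (by gcongr; exact le_max_left _ _),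
    hG.trans (by gcongr; exact le_max_right _ _), hκ, hμ, fun Φ Ψ hΦ => ?_, fun Φ Ψ hΦ => ?_⟩
  · have := hF' (Φ, Ψ) hΦ
    rw [inner_sub_left, real_inner_smul_left, real_inner_smul_left, inner_mulField_left] at this
    simp only at this
    linarith
  · have := hG' (Φ, Ψ) hΦ
    rw [real_inner_smul_left, inner_mulField_left] at this
    simp only at this
    linarith

/-! ### Two-sided bounds for the indicator function -/

/-- The weight `d²/c` is what completing the square in `c|u|² - 2d u·v` leaves on `|v|²`. -/
theorem memLp_top_sq_div {c d : E3 → ℝ} (hc : MemLp c ⊤ volume) (hd : MemLp d ⊤ volume) {k : ℝ}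
    (hk : 0 < k) (hkc : ∀ᵐ x, k ≤ c x) : MemLp (fun x => d x ^ 2 / c x) ⊤ volume := by
  have hinv : MemLp (fun x => (c x)⁻¹) ⊤ volume := by
    refine memLp_top_of_bound hc.1.aemeasurable.inv.aestronglyMeasurable k⁻¹ ?_
    filter_upwards [hkc] with x hx
    rw [Real.norm_eq_abs, abs_of_pos (inv_pos.2 (hk.trans_le hx))]
    exact inv_anti₀ hk hx
  have h : MemLp (fun x => d x * d x) ⊤ volume := hd.mul' hd
  have h' : MemLp (fun x => (d x * d x) * (c x)⁻¹) ⊤ volume := hinv.mul' h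
  simpa only [pow_two, div_eq_mul_inv] using h'

theorem integral_sub_mul_norm_sq {a₁ a₂ b₁ b₂ : E3 → ℝ} (ha₁ : MemLp a₁ ⊤ volume)
    (ha₂ : MemLp a₂ ⊤ volume) (hb₁ : MemLp b₁ ⊤ volume) (hb₂ : MemLp b₂ ⊤ volume)
    (u v : L2Field) :
    ∫ x, ((a₁ x - a₂ x) * ‖u x‖ ^ 2 + (b₁ x - b₂ x) * ‖v x‖ ^ 2) =
      weightedInner a₁ u u - weightedInner a₂ u u
        + (weightedInner b₁ v v - weightedInner b₂ v v) := by
  simp only [weightedInner]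
  have i1 := integrable_weightedInner ha₁ u u
  have i2 := integrable_weightedInner ha₂ u u
  have i3 := integrable_weightedInner hb₁ v v
  have i4 := integrable_weightedInner hb₂ v v
  rw [← integral_sub i1 i2, ← integral_sub i3 i4]
  refine Eq.trans ?_ (integral_add (i1.sub i2) (i3.sub i4))
  refine integral_congr_ae (Eventually.of_forall fun x => ?_)
  simp only [real_inner_self_eq_norm_sq]
  ring

theorem IsMedium.exists_lower_bound {ε μ σ : E3 → ℝ} (h : IsMedium ε μ σ) :
    ∃ k : ℝ, 0 < k ∧ (∀ τ : ℝ, 0 < τ → ∀ᵐ x, k ≤ effPermittivity ε σ τ x) ∧ ∀ᵐ x, k ≤ μ x := by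
  obtain ⟨k₁, hk₁, h₁⟩ := h.permittivity_pos
  obtain ⟨k₂, hk₂, h₂⟩ := h.permeability_pos
  refine ⟨min k₁ k₂, lt_min hk₁ hk₂, fun τ hτ => ?_, ?_⟩
  · filter_upwards [h₁, h.conductivity_nonneg] with x hx hσ
    have := div_nonneg hσ hτ.le
    exact (min_le_left _ _).trans (by rw [effPermittivity]; linarith)
  · filter_upwards [h₂] with x hx
    exact (min_le_right _ _).trans hx

/-- The truncated Laplace transforms of the fields are of order `τ ^ (-5 / 2)`, and solve the
stationary system up to exponentially small errors. -/
theorem IsWeakMaxwellSolution.exists_isStationarySolution_bound {T : ℝ} {ε μ σ : E3 → ℝ}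
    {f : ℝ → ℝ} {p : E3} {η : ℝ} {a : E3} {E H : ℝ → L2Field} (hT : 0 < T)
    (hmed : IsMedium ε μ σ) (hf : MemH1 T f) (hf0 : f 0 = 0)
    (hEH : IsWeakMaxwellSolution T ε μ σ (currentDensity f (Metric.ball p η) a) E H) :
    ∃ A : ℝ, ∀ τ : ℝ, 1 ≤ τ → ∃ F G : L2Field,
      IsStationarySolution τ (effPermittivity ε σ τ) μ (laplaceScalar T f τ) (ballField p η a)
        F G (laplaceField T E τ) (laplaceField T H τ) ∧
      (‖F‖ ≤ A * Real.exp (-(τ * T)) ∧ ‖G‖ ≤ A * Real.exp (-(τ * T))) ∧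
      ‖laplaceField T E τ‖ ≤ A * τ ^ (-(5 / 2) : ℝ) ∧
      ‖laplaceField T H τ‖ ≤ A * τ ^ (-(5 / 2) : ℝ) := by
  have hfi : IntegrableOn f (Ioo 0 T) :=
    (hf.1.integrableOn_compact isCompact_Icc).mono_set Ioo_subset_Icc_self
  obtain ⟨C, hC, h⟩ := hEH.exists_isStationarySolution hT hmed hfi
  obtain ⟨C₁, hC₁, h₁⟩ := hf.abs_laplace_le hT hf0
  obtain ⟨k, hk, hkε, hkμ⟩ := hmed.exists_lower_bound
  set s := ballField p η a
  set M : ℝ := 2 * (C₁ * ‖s‖ + C * (2 / T ^ 2)) / k with hM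
  refine ⟨max C M, fun τ hτ => ?_⟩
  have hτ0 : 0 < τ := by linarith
  obtain ⟨F, G, hF, hG, hs⟩ := h τ hτ0
  have hq : 0 < τ ^ (-(3 / 2) : ℝ) := Real.rpow_pos_of_pos hτ0 _
  have hN : ‖laplaceField T E τ‖ + ‖laplaceField T H τ‖ ≤ M * τ ^ (-(5 / 2) : ℝ) := by
    refine (hs.norm_add_norm_le hτ0 hk (hkε τ hτ0) hkμ hF hG).trans ?_
    calc 2 * (|laplaceScalar T f τ| * ‖s‖ + C * Real.exp (-(τ * T))) / (k * τ)
        ≤ 2 * (C₁ * τ ^ (-(3 / 2) : ℝ) * ‖s‖ + C * (2 / T ^ 2 * τ ^ (-(3 / 2) : ℝ))) / (k * τ) := by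
          gcongr
          · exact h₁ τ hτ
          · exact exp_neg_mul_le_rpow hT hτ
      _ = M * (τ ^ (-(3 / 2) : ℝ) / τ) := by
          rw [hM]; field_simp
      _ = M * τ ^ (-(5 / 2) : ℝ) := by
          rw [← Real.rpow_sub_one hτ0.ne']; norm_num
  have hp : 0 < τ ^ (-(5 / 2) : ℝ) := Real.rpow_pos_of_pos hτ0 _
  have hx := Real.exp_pos (-(τ * T))
  have hMA : M * τ ^ (-(5 / 2) : ℝ) ≤ max C M * τ ^ (-(5 / 2) : ℝ) := by
    gcongr; exact le_max_right _ _
  have hCA : C * Real.exp (-(τ * T)) ≤ max C M * Real.exp (-(τ * T)) := by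
    gcongr; exact le_max_left _ _
  have hE := norm_nonneg (laplaceField T E τ)
  have hH := norm_nonneg (laplaceField T H τ)
  exact ⟨F, G, hs, ⟨hF.trans hCA, hG.trans hCA⟩, by linarith, by linarith⟩

/-- Here `x` is the size of the residuals and `q` that of the fields; their product is the rate of
the remainder. -/
theorem abs_inner_sub_inner_le {X : Type*} [NormedAddCommGroup X] [InnerProductSpace ℝ X]
    {F G u v : X} {A B x q : ℝ} (hF : ‖F‖ ≤ A * x) (hG : ‖G‖ ≤ B * x) (hu : ‖u‖ ≤ B * q)
    (hv : ‖v‖ ≤ A * q) : |inner ℝ v G - inner ℝ F u| ≤ 2 * (A * B) * (q * x) := by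
  have h1 : |inner ℝ v G| ≤ A * q * (B * x) :=
    (abs_real_inner_le_norm _ _).trans
      (mul_le_mul hv hG (norm_nonneg _) ((norm_nonneg _).trans hv))
  have h2 : |inner ℝ F u| ≤ A * x * (B * q) :=
    (abs_real_inner_le_norm _ _).trans
      (mul_le_mul hF hu (norm_nonneg _) ((norm_nonneg _).trans hF))
  exact (abs_sub _ _).trans (by linarith)

/-- The upper and lower bounds for the indicator functional of the stationary system. -/
theorem IsStationarySolution.indicator_bounds {τ c k δ δ₁ : ℝ} {κ μ κ₀ μ₀ : E3 → ℝ}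
    {s F G W V F₀ G₀ W₀ V₀ : L2Field} (h : IsStationarySolution τ κ μ c s F G W V)
    (h₀ : IsStationarySolution τ κ₀ μ₀ c s F₀ G₀ W₀ V₀) (hτ : 0 < τ) (hk : 0 < k)
    (hκ : ∀ᵐ x, k ≤ κ x) (hμ : ∀ᵐ x, k ≤ μ x)
    (h11 : |inner ℝ V G - inner ℝ F W| ≤ δ) (h00 : |inner ℝ V₀ G₀ - inner ℝ F₀ W₀| ≤ δ)
    (h10 : |inner ℝ V G₀ - inner ℝ F W₀| ≤ δ₁) (h01 : |inner ℝ V₀ G - inner ℝ F₀ W| ≤ δ₁) :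
    c * inner ℝ s W - c * inner ℝ s W₀ ≤
        τ * (∫ x, (κ₀ x / κ x * (κ₀ x - κ x) * ‖W₀ x‖ ^ 2 + (μ x - μ₀ x) * ‖V₀ x‖ ^ 2))
          + (2 * δ + 2 * δ₁) ∧
      τ * (∫ x, ((κ₀ x - κ x) * ‖W₀ x‖ ^ 2 + μ₀ x / μ x * (μ x - μ₀ x) * ‖V₀ x‖ ^ 2))
          + -(2 * δ + 2 * δ₁) ≤ c * inner ℝ s W - c * inner ℝ s W₀ := by
  have mκ := h.permittivity_bdd
  have mμ := h.permeability_bdd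
  have mκ₀ := h₀.permittivity_bdd
  have mμ₀ := h₀.permeability_bdd
  have mκd := memLp_top_sq_div mκ mκ₀ hk hκ
  have mμd := memLp_top_sq_div mμ mμ₀ hk hμ
  have hκp : ∀ᵐ x, 0 < κ x := hκ.mono fun x hx => hk.trans_le hx
  have hμp : ∀ᵐ x, 0 < μ x := hμ.mono fun x hx => hk.trans_le hx
  -- The first index names the solution whose Ampère law is used, the second the test field; `0` is
  -- the background.
  have r11 := h.reciprocity h
  have r10 := h.reciprocity h₀
  have r01 := h₀.reciprocity h
  have r00 := h₀.reciprocity h₀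
  rw [weightedInner_comm κ₀, weightedInner_comm μ] at r01
  rw [abs_le] at h11 h00 h10 h01
  -- Pointwise, `(κ₀/κ)(κ₀ - κ) = κ₀²/κ - κ₀`; likewise `(μ₀/μ)(μ - μ₀) = μ₀ - μ₀²/μ` in `eL`.
  have eU : ∫ x, (κ₀ x / κ x * (κ₀ x - κ x) * ‖W₀ x‖ ^ 2 + (μ x - μ₀ x) * ‖V₀ x‖ ^ 2) = _ :=
    Eq.trans (integral_congr_ae (by
      filter_upwards [hκp] with x hx
      congr 2
      field_simp)) (integral_sub_mul_norm_sq mκd mκ₀ mμ mμ₀ W₀ V₀)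
  have eL : ∫ x, ((κ₀ x - κ x) * ‖W₀ x‖ ^ 2 + μ₀ x / μ x * (μ x - μ₀ x) * ‖V₀ x‖ ^ 2) = _ :=
    Eq.trans (integral_congr_ae (by
      filter_upwards [hμp] with x hx
      congr 2
      field_simp)) (integral_sub_mul_norm_sq mκ₀ mκ mμ₀ mμd W₀ V₀)
  have hself : ∀ d : E3 → ℝ, ∀ᵐ x, d x * d x = d x ^ 2 := fun d =>
    Eventually.of_forall fun x => (pow_two _).symm
  -- The upper bound is `2·r01 - r11 - r00` with `q1` and `q2`; the lower bound is `r11 - 2·r10 +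
  -- r00` with `q3` and `q4`. Each combination costs `2δ + 2δ₁`.
  have q1 := two_mul_weightedInner_le mκ mκ₀ mκd hκp
    (hκp.mono fun x hx => div_mul_cancel₀ _ hx.ne') W W₀
  have q2 := two_mul_weightedInner_le mμ mμ mμ hμp (hself μ) V V₀
  have q3 := two_mul_weightedInner_le mκ mκ mκ hκp (hself κ) W W₀
  have q4 := two_mul_weightedInner_le mμ mμ₀ mμd hμp
    (hμp.mono fun x hx => div_mul_cancel₀ _ hx.ne') V V₀
  rw [eU, eL]
  have p12 := mul_le_mul_of_nonneg_left (add_le_add q1 q2) hτ.le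
  have p34 := mul_le_mul_of_nonneg_left (add_le_add q3 q4) hτ.le
  constructor <;> linarith

theorem theorem1p1
    -- the media with and without the obstacle `D`
    (ε μ σ ε₀ μ₀ σ₀ : E3 → ℝ) (hmed : IsMedium ε μ σ) (hmed₀ : IsMedium ε₀ μ₀ σ₀)
    (D : Set E3) (hDne : D.Nonempty) (hDo : IsOpen D) (hDb : Bornology.IsBounded D)
    (hDc : IsConnected (closure D)ᶜ)
    (e m h : E3 → ℝ)
    (he : MemLp e ⊤ (volume.restrict D)) (hm : MemLp m ⊤ (volume.restrict D))
    (hh : MemLp h ⊤ (volume.restrict D))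
    (hε : ∀ᵐ x, ε x / ε₀ x = 1 + D.indicator e x)
    (hμ : ∀ᵐ x, μ x / μ₀ x = 1 + D.indicator m x)
    (hσ : ∀ᵐ x, σ x = σ₀ x + D.indicator h x)
    -- the final time and the source
    (T : ℝ) (hT : 0 < T)
    (p : E3) (η : ℝ) (hη : 0 < η) (hBD : Disjoint (closure (Metric.ball p η)) (closure D))
    (a : E3) (ha : ‖a‖ = 1)
    (f : ℝ → ℝ) (hf : MemH1 T f) (hf0 : f 0 = 0)
    -- the fields with and without the obstacle
    (E H E₀ H₀ : ℝ → L2Field)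
    (hEH : IsWeakMaxwellSolution T ε μ σ (currentDensity f (Metric.ball p η) a) E H)
    (hEH₀ : IsWeakMaxwellSolution T ε₀ μ₀ σ₀ (currentDensity f (Metric.ball p η) a) E₀ H₀) :
    (∃ r : ℝ → ℝ,
      (r =O[atTop] fun τ : ℝ => τ ^ (-(5 / 2) : ℝ) * Real.exp (-(τ * T))) ∧
      ∀ᶠ τ : ℝ in atTop,
        indicatorFunction T (currentDensity f (Metric.ball p η) a) E E₀ τ ≤
          τ * (∫ x,
            (effPermittivity ε₀ σ₀ τ x / effPermittivity ε σ τ x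
                * (effPermittivity ε₀ σ₀ τ x - effPermittivity ε σ τ x)
                * ‖laplaceField T E₀ τ x‖ ^ 2
              + (μ x - μ₀ x) * ‖laplaceField T H₀ τ x‖ ^ 2)) + r τ) ∧
    (∃ r : ℝ → ℝ,
      (r =O[atTop] fun τ : ℝ => τ ^ (-(5 / 2) : ℝ) * Real.exp (-(τ * T))) ∧
      ∀ᶠ τ : ℝ in atTop,
        τ * (∫ x,
            ((effPermittivity ε₀ σ₀ τ x - effPermittivity ε σ τ x)
                * ‖laplaceField T E₀ τ x‖ ^ 2
              + μ₀ x / μ x * (μ x - μ₀ x) * ‖laplaceField T H₀ τ x‖ ^ 2)) + r τ ≤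
          indicatorFunction T (currentDensity f (Metric.ball p η) a) E E₀ τ) := by
  obtain ⟨A₁, h₁⟩ := hEH.exists_isStationarySolution_bound hT hmed hf hf0
  obtain ⟨A₀, h₀⟩ := hEH₀.exists_isStationarySolution_bound hT hmed₀ hf hf0
  obtain ⟨k, hk, hkε, hkμ⟩ := hmed.exists_lower_bound
  set A := max A₁ A₀ with hA
  set g : ℝ → ℝ := fun τ => τ ^ (-(5 / 2) : ℝ) * Real.exp (-(τ * T)) with hg
  have hmain : ∀ τ : ℝ, 1 ≤ τ → ∃ F G F₀ G₀ : L2Field,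
      IsStationarySolution τ (effPermittivity ε σ τ) μ (laplaceScalar T f τ) (ballField p η a)
        F G (laplaceField T E τ) (laplaceField T H τ) ∧
      IsStationarySolution τ (effPermittivity ε₀ σ₀ τ) μ₀ (laplaceScalar T f τ) (ballField p η a)
        F₀ G₀ (laplaceField T E₀ τ) (laplaceField T H₀ τ) ∧
      |inner ℝ (laplaceField T H τ) G - inner ℝ F (laplaceField T E τ)|
        ≤ 2 * (A * A) * g τ ∧
      |inner ℝ (laplaceField T H₀ τ) G₀ - inner ℝ F₀ (laplaceField T E₀ τ)|
        ≤ 2 * (A * A) * g τ ∧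
      |inner ℝ (laplaceField T H τ) G₀ - inner ℝ F (laplaceField T E₀ τ)|
        ≤ 2 * (A * A) * g τ ∧
      |inner ℝ (laplaceField T H₀ τ) G - inner ℝ F₀ (laplaceField T E τ)|
        ≤ 2 * (A * A) * g τ := by
    intro τ hτ
    have hτ0 : 0 < τ := by linarith
    have hx := Real.exp_pos (-(τ * T))
    have hq : 0 < τ ^ (-(5 / 2) : ℝ) := Real.rpow_pos_of_pos hτ0 _
    obtain ⟨F, G, hs, ⟨hF, hG⟩, hW, hV⟩ := h₁ τ hτ
    obtain ⟨F₀, G₀, hs₀, ⟨hF₀, hG₀⟩, hW₀, hV₀⟩ := h₀ τ hτ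
    have le₁ : ∀ {x : ℝ}, 0 < x → A₁ * x ≤ A * x := fun hx =>
      mul_le_mul_of_nonneg_right (le_max_left _ _) hx.le
    have le₀ : ∀ {x : ℝ}, 0 < x → A₀ * x ≤ A * x := fun hx =>
      mul_le_mul_of_nonneg_right (le_max_right _ _) hx.le
    replace hF := hF.trans (le₁ hx)
    replace hG := hG.trans (le₁ hx)
    replace hW := hW.trans (le₁ hq)
    replace hV := hV.trans (le₁ hq)
    replace hF₀ := hF₀.trans (le₀ hx)
    replace hG₀ := hG₀.trans (le₀ hx)
    replace hW₀ := hW₀.trans (le₀ hq)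
    replace hV₀ := hV₀.trans (le₀ hq)
    exact ⟨F, G, F₀, G₀, hs, hs₀,
      abs_inner_sub_inner_le hF hG hW hV, abs_inner_sub_inner_le hF₀ hG₀ hW₀ hV₀,
      abs_inner_sub_inner_le hF hG₀ hW₀ hV, abs_inner_sub_inner_le hF₀ hG hW hV₀⟩
  -- This is `2δ + 2δ₁` with `δ = δ₁ = 2A² g`; the lower bound uses its negative.
  have hO : (fun τ => 2 * (2 * (A * A) * g τ) + 2 * (2 * (A * A) * g τ)) =O[atTop] g := by
    have h : (fun τ => 2 * (2 * (A * A) * g τ) + 2 * (2 * (A * A) * g τ))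
        = fun τ => 8 * (A * A) * g τ := by funext τ; ring
    rw [h]
    exact isBigO_const_mul_self _ _ _
  refine ⟨⟨_, hO, ?_⟩, ⟨_, hO.neg_left, ?_⟩⟩ <;>
    filter_upwards [eventually_ge_atTop 1] with τ hτ <;>
    obtain ⟨F, G, F₀, G₀, hs, hs₀, h11, h00, h10, h01⟩ := hmain τ hτ <;>
    have hτ0 : 0 < τ := zero_lt_one.trans_le hτ <;>
    have hb := hs.indicator_bounds hs₀ hτ0 hk (hkε τ hτ0) hkμ h11 h00 h10 h01 <;>
    rw [indicatorFunction_eq]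
  · exact hb.1
  · exact hb.2
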